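/- Let $d\ge 1$, let $\Omega\subset\mathbb{R}^d$ be nonempty, open and bounded, and let $T>0$. Let $H^1_0(\Omega)$ carry the scalar product $\langle v,w\rangle_{H^1_0}=\int_\Omega\nabla v\cdot\nabla w\,dx$, let $\mathcal{A}=-\Delta:H^1_0(\Omega)\to H^{-1}(\Omega)$ be the Dirichlet Laplacian, $\langle f,g\rangle_{H^{-1}}=\int_\Omega\nabla\mathcal{A}^{-1}f\cdot\nabla\mathcal{A}^{-1}g\,dx$, let $\mathcal{A}^{-1/2}$ be the positive square root of $\mathcal{A}^{-1}$ on $L^2(\Omega)$ (it maps $L^2(\Omega)$ into $H^1_0(\Omega)$), and let $e^{-\mathcal{A}t}$ be the heat semigroup on $L^2(\Omega)$, i.e. $v(t)=e^{-\mathcal{A}t}g$ solves $v'=-\mathcal{A}v$ for $t>0$, $v(0)=g$. Let $$U_0=\{u\in L^2(0,T;H^1_0(\Omega))\cap H^1(0,T;H^{-1}(\Omega)) : u(0)=0\}$$ (values at a fixed time are those of the representative in $C([0,T];L^2(\Omega))$) with scalar product $$\langle u,v\rangle_{U_0}=\int_0^T\!\!\int_\Omega\left(\nabla u\cdot\nabla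 v+\nabla\mathcal{A}^{-1}u_t\cdot\nabla\mathcal{A}^{-1}v_t\right)dx\,dt+\int_\Omega u(T)v(T)\,dx ,$$ and give $U_0\times H^1_0(\Omega)$ the sum of the two scalar products. Put $\delta_Tu=u(T)$, $Bu=\int_0^Tu(t)\,dt$, $(\underline{I}\theta)(t)=\theta$, let $I$ denote identities and the embedding $H^1_0(\Omega)\to L^2(\Omega)$, and let $$\mathcal{G}=\begin{pmatrix}\partial_t+\mathcal{A}&\underline{I}\mathcal{A}\\ \delta_T&I\end{pmatrix}:U_0\times H^1_0(\Omega)\to L^2(0,T;H^{-1}(\Omega))\times L^2(\Omega),\qquad \psi(\mathcal{C}_0)=\begin{pmatrix}I&\underline{I}-e^{-\mathcal{A}t}\\ \mathcal{A}^{-1}\delta_T+B&\mathcal{A}^{-1/2}\end{pmatrix},$$ $$\tilde{\mathcal{A}}=\begin{pmatrix}I&0\\0&\mathcal{A}^{-1/2}\end{pmatrix},\qquad \tilde{\mathcal{C}}=\begin{pmatrix}I&\underline{I}-e^{-\mathcal{A}t}\\ \mathcal{A}^{-1/2}\delta_T&\mathcal{A}^{-1/2}\end{pmatrix},\qquad \mathcal{R}=\begin{pmatrix}0&0\\B&\mathcal{A}^{-1/2}-\mathcal{A}^{-1}\end{pmatrix}.$$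 Then: 1. $\psi(\mathcal{C}_0)$, $\tilde{\mathcal{A}}$, $\tilde{\mathcal{C}}$ and $\mathcal{R}$ map $U_0\times H^1_0(\Omega)$ into itself. 2. $\psi(\mathcal{C}_0)$ is symmetric: $\langle\psi(\mathcal{C}_0)\mathbf{x},\mathbf{y}\rangle_{U_0\times H^1_0}=\langle\mathbf{x},\psi(\mathcal{C}_0)\mathbf{y}\rangle_{U_0\times H^1_0}$ for all $\mathbf{x},\mathbf{y}\in U_0\times H^1_0(\Omega)$. 3. $\psi(\mathcal{C}_0)=\tilde{\mathcal{A}}\tilde{\mathcal{C}}+\mathcal{R}$ on $U_0\times H^1_0(\Omega)$. 4. $\mathcal{R}$ is of lower order than $\tilde{\mathcal{C}}$ in the following sense: there is a constant $C$ with $$\|\mathcal{R}(u,\theta)\|_{U_0\times H^1_0}\le C\left(\|u\|_{L^2(0,T;H^1_0)}^2+\|\theta\|_{L^2}^2\right)^{1/2}\quad\text{for all }(u,\theta)\in U_0\times H^1_0(\Omega),$$ whereas no constant $C$ gives this estimate with $\tilde{\mathcal{C}}$ in place of $\mathcal{R}$. 5. $\|\tilde{\mathcal{C}}\mathbf{x}\|_{U_0\times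 H^1_0}=\|\mathcal{G}\mathbf{x}\|_{L^2(0,T;H^{-1})\times L^2}$ for all $\mathbf{x}\in U_0\times H^1_0(\Omega)$. -/

import Mathlib

open MeasureTheory Set
open scoped ContDiff

noncomputable section

namespace BackwardHeat

variable {d : ℕ}

/-! ### Spaces of functions on `Ω` -/

/-- `L²(Ω)`. -/
abbrev L2 (Ω : Set (EuclideanSpace ℝ (Fin d))) : Type :=
  Lp ℝ 2 (volume.restrict Ω)

/-- `L²(Ω; ℝᵈ)`, the space of gradients. -/
abbrev L2Vec (Ω : Set (EuclideanSpace ℝ (Fin d))) : Type :=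
  Lp (EuclideanSpace ℝ (Fin d)) 2 (volume.restrict Ω)

/-- The pairs `(φ, ∇φ)`, `φ ∈ C_c^∞(Ω)`, inside `L²(Ω) × L²(Ω; ℝᵈ)`. -/
def testPairs (Ω : Set (EuclideanSpace ℝ (Fin d))) : Set (WithLp 2 (L2 Ω × L2Vec Ω)) :=
  {p | ∃ φ : EuclideanSpace ℝ (Fin d) → ℝ, ContDiff ℝ ∞ φ ∧ HasCompactSupport φ ∧
    tsupport φ ⊆ Ω ∧ (p.fst : EuclideanSpace ℝ (Fin d) → ℝ) =ᵐ[volume.restrict Ω] φ ∧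
    (p.snd : EuclideanSpace ℝ (Fin d) → EuclideanSpace ℝ (Fin d))
      =ᵐ[volume.restrict Ω] fun x => gradient φ x}

/-- `H¹₀(Ω)`: the closure of `C_c^∞(Ω)` in the `H¹` norm. A function `v` is stored as the pair
`(v, ∇v)` of the function and its weak gradient; the norm of the type is the full `H¹` norm. -/
def H10 (Ω : Set (EuclideanSpace ℝ (Fin d))) : Submodule ℝ (WithLp 2 (L2 Ω × L2Vec Ω)) :=
  (Submodule.span ℝ (testPairs Ω)).topologicalClosure

/-- The embedding `I : H¹₀(Ω) → L²(Ω)`. -/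
def emb (Ω : Set (EuclideanSpace ℝ (Fin d))) : H10 Ω →L[ℝ] L2 Ω :=
  (WithLp.fstL 2 ℝ (L2 Ω) (L2Vec Ω)).comp (H10 Ω).subtypeL

/-- The weak gradient `∇ : H¹₀(Ω) → L²(Ω; ℝᵈ)`. -/
def grad (Ω : Set (EuclideanSpace ℝ (Fin d))) : H10 Ω →L[ℝ] L2Vec Ω :=
  (WithLp.sndL 2 ℝ (L2 Ω) (L2Vec Ω)).comp (H10 Ω).subtypeL

/-- The scalar product `∫_Ω ∇v · ∇w dx` of `H¹₀(Ω)`. -/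
def innerH10 (Ω : Set (EuclideanSpace ℝ (Fin d))) (v w : H10 Ω) : ℝ :=
  inner ℝ (grad Ω v) (grad Ω w)

/-- `H⁻¹(Ω)`, the dual space of `H¹₀(Ω)`. -/
abbrev Hm1 (Ω : Set (EuclideanSpace ℝ (Fin d))) : Type := H10 Ω →L[ℝ] ℝ

/-- The embedding `L²(Ω) → H⁻¹(Ω)`, `g ↦ (v ↦ ∫_Ω g v dx)`. -/
def embDual (Ω : Set (EuclideanSpace ℝ (Fin d))) : L2 Ω →L[ℝ] Hm1 Ω :=
  (innerSL ℝ).bilinearComp (ContinuousLinearMap.id ℝ (L2 Ω)) (emb Ω)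

/-- `𝒜 = -Δ : H¹₀(Ω) → H⁻¹(Ω)` with homogeneous Dirichlet conditions,
`⟨𝒜 w, v⟩ = ∫_Ω ∇w · ∇v dx`. -/
def opA (Ω : Set (EuclideanSpace ℝ (Fin d))) : H10 Ω →L[ℝ] Hm1 Ω :=
  (innerSL ℝ).bilinearComp (grad Ω) (grad Ω)

/-- `𝒜⁻¹ : H⁻¹(Ω) → H¹₀(Ω)`. -/
def invA (Ω : Set (EuclideanSpace ℝ (Fin d))) : Hm1 Ω →L[ℝ] H10 Ω :=
  (opA Ω).inverse

/-- The scalar product `∫_Ω ∇𝒜⁻¹f · ∇𝒜⁻¹g dx` of `H⁻¹(Ω)`. -/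
def innerHm1 (Ω : Set (EuclideanSpace ℝ (Fin d))) (f g : Hm1 Ω) : ℝ :=
  innerH10 Ω (invA Ω f) (invA Ω g)

/-- `𝒜⁻¹ : L²(Ω) → H¹₀(Ω)`. -/
def invAL2 (Ω : Set (EuclideanSpace ℝ (Fin d))) : L2 Ω →L[ℝ] H10 Ω :=
  (invA Ω).comp (embDual Ω)

/-- `S : L²(Ω) → H¹₀(Ω)` is, as an operator on `L²(Ω)`, the positive square root of `𝒜⁻¹`. -/
def IsInvSqrt (Ω : Set (EuclideanSpace ℝ (Fin d))) (S : L2 Ω →L[ℝ] H10 Ω) : Prop :=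
  ((emb Ω).comp S).IsPositive ∧
    ((emb Ω).comp S).comp ((emb Ω).comp S) = (emb Ω).comp (invAL2 Ω)

open Classical in
/-- `𝒜^{-1/2} : L²(Ω) → H¹₀(Ω)`. -/
def invSqrtA (Ω : Set (EuclideanSpace ℝ (Fin d))) : L2 Ω →L[ℝ] H10 Ω :=
  if h : ∃ S, IsInvSqrt Ω S then h.choose else 0

/-! ### The heat semigroup -/

/-- `v` is the solution of `v' = -𝒜 v` on `(0,∞)`, `v(0) = g`: it is continuous on `[0,∞)` with
values in `L²(Ω)`, and for `t > 0` it is differentiable in `L²(Ω)`, takes values in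
`H¹₀(Ω)` and satisfies the equation. -/
def IsHeatFlow (Ω : Set (EuclideanSpace ℝ (Fin d))) (g : L2 Ω) (v : ℝ → L2 Ω) : Prop :=
  ContinuousOn v (Ici 0) ∧ v 0 = g ∧
    ∀ t, 0 < t → ∃ (p : H10 Ω) (v' : L2 Ω),
      emb Ω p = v t ∧ HasDerivAt v v' t ∧ embDual Ω v' = -opA Ω p

open Classical in
/-- The heat semigroup: `e^{-𝒜t} g` is the value at time `t ≥ 0` of the solution of the heat
equation with initial value `g`. -/
def heatSemigroup (Ω : Set (EuclideanSpace ℝ (Fin d))) (t : ℝ) (g : L2 Ω) : L2 Ω :=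
  if h : ∃ v, IsHeatFlow Ω g v then h.choose t else 0

/-! ### Bochner spaces on `(0,T)` -/

/-- `L²(0,T;H¹₀(Ω))`. -/
abbrev L2H10 (T : ℝ) (Ω : Set (EuclideanSpace ℝ (Fin d))) : Type :=
  Lp (H10 Ω) 2 (volume.restrict (Ioo (0 : ℝ) T))

/-- `L²(0,T;H⁻¹(Ω))`. -/
abbrev L2Hm1 (T : ℝ) (Ω : Set (EuclideanSpace ℝ (Fin d))) : Type :=
  Lp (Hm1 Ω) 2 (volume.restrict (Ioo (0 : ℝ) T))

/-- The scalar product of `L²(0,T;H⁻¹(Ω))`. -/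
def innerL2Hm1 (T : ℝ) (Ω : Set (EuclideanSpace ℝ (Fin d))) (f g : L2Hm1 T Ω) : ℝ :=
  ∫ t in Ioo (0 : ℝ) T, innerHm1 Ω (f t) (g t)

/-- The scalar product `∫_0^T ∫_Ω ∇u · ∇v dx dt` of `L²(0,T;H¹₀(Ω))`. -/
def innerL2H10 (T : ℝ) (Ω : Set (EuclideanSpace ℝ (Fin d))) (u v : L2H10 T Ω) : ℝ :=
  ∫ t in Ioo (0 : ℝ) T, innerH10 Ω (u t) (v t)

/-- `g ∈ L²(0,T;H⁻¹)` is the weak time derivative of `u`. -/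
def HasWeakTimeDeriv (T : ℝ) (Ω : Set (EuclideanSpace ℝ (Fin d))) (u : L2H10 T Ω)
    (g : L2Hm1 T Ω) : Prop :=
  ∀ φ : ℝ → ℝ, ContDiff ℝ ∞ φ → HasCompactSupport φ → tsupport φ ⊆ Ioo 0 T →
    ∫ t in Ioo (0 : ℝ) T, deriv φ t • embDual Ω (emb Ω (u t)) =
      -∫ t in Ioo (0 : ℝ) T, φ t • g t

open Classical in
/-- The weak time derivative `∂ₜ u ∈ L²(0,T;H⁻¹)`. -/
def timeDeriv (T : ℝ) (Ω : Set (EuclideanSpace ℝ (Fin d))) (u : L2H10 T Ω) : L2Hm1 T Ω :=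
  if h : ∃ g, HasWeakTimeDeriv T Ω u g then h.choose else 0

/-- `v` is the representative of `u` in `C([0,T];L²(Ω))`. -/
def IsContRep (T : ℝ) (Ω : Set (EuclideanSpace ℝ (Fin d))) (u : L2H10 T Ω)
    (v : ℝ → L2 Ω) : Prop :=
  ContinuousOn v (Icc 0 T) ∧ ∀ᵐ t ∂(volume.restrict (Ioo (0 : ℝ) T)), emb Ω (u t) = v t

open Classical in
/-- The value at final time `δ_T u = u(T) ∈ L²(Ω)`, taken from the continuous representative. -/
def deltaT (T : ℝ) (Ω : Set (EuclideanSpace ℝ (Fin d))) (u : L2H10 T Ω) : L2 Ω :=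
  if h : ∃ v, IsContRep T Ω u v then h.choose T else 0

/-- `U₀ = {u ∈ L²(0,T;H¹₀) ∩ H¹(0,T;H⁻¹) : u(0) = 0}`. -/
def U0 (T : ℝ) (Ω : Set (EuclideanSpace ℝ (Fin d))) : Set (L2H10 T Ω) :=
  {u | (∃ g, HasWeakTimeDeriv T Ω u g) ∧ ∃ v, IsContRep T Ω u v ∧ v 0 = 0}

/-- The scalar product of `U₀`:
`∫_0^T ∫_Ω (∇u · ∇v + ∇𝒜⁻¹uₜ · ∇𝒜⁻¹vₜ) dx dt + ∫_Ω u(T) v(T) dx`. -/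
def innerU0 (T : ℝ) (Ω : Set (EuclideanSpace ℝ (Fin d))) (u v : L2H10 T Ω) : ℝ :=
  innerL2H10 T Ω u v + innerL2Hm1 T Ω (timeDeriv T Ω u) (timeDeriv T Ω v)
    + inner ℝ (deltaT T Ω u) (deltaT T Ω v)

/-! ### The product space and the block operators -/

/-- The ambient space `L²(0,T;H¹₀) × H¹₀` of `U₀ × H¹₀`. -/
abbrev State (T : ℝ) (Ω : Set (EuclideanSpace ℝ (Fin d))) : Type := L2H10 T Ω × H10 Ω

/-- `U₀ × H¹₀(Ω)`. -/
def stateSpace (T : ℝ) (Ω : Set (EuclideanSpace ℝ (Fin d))) : Set (State T Ω) :=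
  U0 T Ω ×ˢ univ

/-- The scalar product of `U₀ × H¹₀(Ω)`. -/
def innerState (T : ℝ) (Ω : Set (EuclideanSpace ℝ (Fin d))) (x y : State T Ω) : ℝ :=
  innerU0 T Ω x.1 y.1 + innerH10 Ω x.2 y.2

/-- The norm of `U₀ × H¹₀(Ω)`. -/
def normState (T : ℝ) (Ω : Set (EuclideanSpace ℝ (Fin d))) (x : State T Ω) : ℝ :=
  √(innerState T Ω x x)

/-- The norm of `L²(0,T;H¹₀(Ω)) × L²(Ω)`, evaluated at `(u, θ)`. -/
def weakNorm (T : ℝ) (Ω : Set (EuclideanSpace ℝ (Fin d))) (x : State T Ω) : ℝ :=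
  √(innerL2H10 T Ω x.1 x.1 + ‖emb Ω x.2‖ ^ 2)

/-- `[[a, b], [c, e]]` acting on pairs. -/
def block {X₁ X₂ Y₁ Y₂ : Type*} [Add Y₁] [Add Y₂]
    (a : X₁ → Y₁) (b : X₂ → Y₁) (c : X₁ → Y₂) (e : X₂ → Y₂) (x : X₁ × X₂) : Y₁ × Y₂ :=
  (a x.1 + b x.2, c x.1 + e x.2)

/-- `𝒢 = [[∂ₜ + 𝒜, I̲𝒜], [δ_T, I]]`, with values in `L²(0,T;H⁻¹) × L²(Ω)`. -/
def opG (T : ℝ) (Ω : Set (EuclideanSpace ℝ (Fin d))) : State T Ω → L2Hm1 T Ω × L2 Ω :=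
  block (fun u : L2H10 T Ω => timeDeriv T Ω u + ContinuousLinearMap.compLp (σ := RingHom.id ℝ) (opA Ω) u)
    (fun θ => Lp.const 2 (volume.restrict (Ioo (0 : ℝ) T)) (opA Ω θ))
    (deltaT T Ω) (emb Ω)

/-- The norm of `L²(0,T;H⁻¹) × L²(Ω)`. -/
def normData (T : ℝ) (Ω : Set (EuclideanSpace ℝ (Fin d))) (y : L2Hm1 T Ω × L2 Ω) : ℝ :=
  √(innerL2Hm1 T Ω y.1 y.1 + ‖y.2‖ ^ 2)

/-- `I̲ : H¹₀ → L²(0,T;H¹₀)`, `θ ↦ (t ↦ θ)`. -/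
def constInTime (T : ℝ) (Ω : Set (EuclideanSpace ℝ (Fin d))) (θ : H10 Ω) : L2H10 T Ω :=
  Lp.const 2 (volume.restrict (Ioo (0 : ℝ) T)) θ

open Classical in
/-- `e^{-𝒜t} : H¹₀ → L²(0,T;H¹₀)`, `θ ↦ (t ↦ e^{-𝒜t} θ)`. -/
def heatOrbit (T : ℝ) (Ω : Set (EuclideanSpace ℝ (Fin d))) (θ : H10 Ω) : L2H10 T Ω :=
  if h : ∃ w : L2H10 T Ω, ∀ᵐ t ∂(volume.restrict (Ioo (0 : ℝ) T)),
      emb Ω (w t) = heatSemigroup Ω t (emb Ω θ)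
  then h.choose else 0

/-- `I̲ - e^{-𝒜t}`. -/
def relax (T : ℝ) (Ω : Set (EuclideanSpace ℝ (Fin d))) (θ : H10 Ω) : L2H10 T Ω :=
  constInTime T Ω θ - heatOrbit T Ω θ

/-- `B u = ∫_0^T u(t) dt ∈ H¹₀(Ω)`. -/
def opB (T : ℝ) (Ω : Set (EuclideanSpace ℝ (Fin d))) (u : L2H10 T Ω) : H10 Ω :=
  ∫ t in Ioo (0 : ℝ) T, u t

/-- `ψ(𝒞₀) = [[I, I̲ - e^{-𝒜t}], [𝒜⁻¹δ_T + B, 𝒜^{-1/2}]]`. -/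
def psiC0 (T : ℝ) (Ω : Set (EuclideanSpace ℝ (Fin d))) : State T Ω → State T Ω :=
  block id (relax T Ω)
    (fun u => invAL2 Ω (deltaT T Ω u) + opB T Ω u) (fun θ => invSqrtA Ω (emb Ω θ))

/-- `𝒜̃ = [[I, 0], [0, 𝒜^{-1/2}]]`. -/
def opAtilde (T : ℝ) (Ω : Set (EuclideanSpace ℝ (Fin d))) : State T Ω → State T Ω :=
  block id 0 0 (fun θ => invSqrtA Ω (emb Ω θ))

/-- `𝒞̃ = [[I, I̲ - e^{-𝒜t}], [𝒜^{-1/2}δ_T, 𝒜^{-1/2}]]`. -/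
def opCtilde (T : ℝ) (Ω : Set (EuclideanSpace ℝ (Fin d))) : State T Ω → State T Ω :=
  block id (relax T Ω)
    (fun u => invSqrtA Ω (deltaT T Ω u)) (fun θ => invSqrtA Ω (emb Ω θ))

/-- `ℛ = [[0, 0], [B, 𝒜^{-1/2} - 𝒜⁻¹]]`. -/
def opR (T : ℝ) (Ω : Set (EuclideanSpace ℝ (Fin d))) : State T Ω → State T Ω :=
  block 0 0 (opB T Ω) (fun θ => invSqrtA Ω (emb Ω θ) - invAL2 Ω (emb Ω θ))

end BackwardHeat

end

open BackwardHeat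

open MeasureTheory Set
open scoped ContDiff

noncomputable section

namespace BackwardHeat

variable {d : ℕ} {Ω : Set (EuclideanSpace ℝ (Fin d))} {T : ℝ}

/-! Two facts carry the theorem.

The energy identity `inner_gradInvT_add`: for u, v in U₀ the pairings satisfy ⟨u_t, v⟩ + ⟨v_t, u⟩ =
(u(T), v(T)). Expanding the square gives ‖z_t + 𝒜z‖² = ‖z_t‖² + ‖z‖² + ‖z(T)‖², so ∂ₜ + 𝒜 is
isometric from U₀ to L²(0,T;H⁻¹). Moreover z = (I̲ - e^{-𝒜t})θ lies in U₀ and solves z_t + 𝒜z = 𝒜θ.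
Hence the first row of 𝒢 is ∂ₜ + 𝒜 applied to the first row of 𝒞̃. Since 𝒜^{-1/2} is isometric from
L² to H¹₀, the second rows have equal norms too, which is the equality of norms. The same identity,
polarised, shows that I̲ - e^{-𝒜t} has the adjoint 𝒜⁻¹δ_T + B (`innerU0_relax`), which is the
symmetry of ψ(𝒞₀). The splitting is 𝒜^{-1/2}𝒜^{-1/2} = 𝒜⁻¹.

The Dirichlet eigenbasis (`exists_dirichletBasis`), from Poincaré's inequality, Rellich's theorem
and the spectral theorem. It turns 𝒜^{-1/2} and e^{-𝒜t} into multipliers, identifies the objects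
defined by choice, and reduces the energy identity to the product rule for scalar primitives.

For the orders, ℛ is bounded by Cauchy-Schwarz in time and by the mapping properties of 𝒜^{-1/2} and
𝒜⁻¹. In contrast 𝒞̃ sees u(T), which the L²(0,T;H¹₀) norm does not control: t^{n+1}p with large n
concentrates at T. -/

/-! ### Test functions and H¹₀(Ω). -/

theorem HasCompactSupport.gradient' {φ : EuclideanSpace ℝ (Fin d) → ℝ} (hc : HasCompactSupport φ) :
    HasCompactSupport (gradient φ) := by
  have := hc.fderiv (𝕜 := ℝ)
  exact this.comp_left (g := (InnerProductSpace.toDual ℝ (EuclideanSpace ℝ (Fin d))).symm) (by simp)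

theorem continuous_gradient_of_contDiff {φ : EuclideanSpace ℝ (Fin d) → ℝ} (h : ContDiff ℝ ∞ φ) :
    Continuous (gradient φ) := by
  exact (InnerProductSpace.toDual ℝ (EuclideanSpace ℝ (Fin d))).symm.continuous.comp
    (h.continuous_fderiv (by simp))

theorem inner_gradient {φ : EuclideanSpace ℝ (Fin d) → ℝ} (x z : EuclideanSpace ℝ (Fin d)) :
    inner ℝ (gradient φ x) z = fderiv ℝ φ x z := by
  simp [gradient]

/-- A test function, as an element of `H¹₀(Ω)`. -/
theorem exists_testPair {φ : EuclideanSpace ℝ (Fin d) → ℝ} (h : ContDiff ℝ ∞ φ)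
    (hc : HasCompactSupport φ) (hs : tsupport φ ⊆ Ω) : ∃ v : H10 Ω, 
    (emb Ω v : EuclideanSpace ℝ (Fin d) → ℝ) =ᵐ[volume.restrict Ω] φ ∧
    (grad Ω v : EuclideanSpace ℝ (Fin d) → EuclideanSpace ℝ (Fin d))
      =ᵐ[volume.restrict Ω] fun x => gradient φ x := by
  have h1 : MemLp φ 2 (volume.restrict Ω) := (h.continuous.memLp_of_hasCompactSupport hc).restrict _
  have h2 : MemLp (gradient φ) 2 (volume.restrict Ω) :=
    ((continuous_gradient_of_contDiff h).memLp_of_hasCompactSupport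
      (HasCompactSupport.gradient' hc)).restrict _
  refine ⟨⟨WithLp.toLp 2 (h1.toLp, h2.toLp), ?_⟩, h1.coeFn_toLp, h2.coeFn_toLp⟩
  exact Submodule.le_topologicalClosure _ (Submodule.subset_span
    ⟨φ, h, hc, hs, h1.coeFn_toLp, h2.coeFn_toLp⟩)

/-- Closed conditions on `H¹₀(Ω)` need only be checked on test functions. -/
theorem H10.induction {P : H10 Ω → Prop} (hP : IsClosed {v | P v})
    (h : ∀ (v : H10 Ω) (φ : EuclideanSpace ℝ (Fin d) → ℝ), ContDiff ℝ ∞ φ → HasCompactSupport φ →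
      tsupport φ ⊆ Ω → (emb Ω v : EuclideanSpace ℝ (Fin d) → ℝ) =ᵐ[volume.restrict Ω] φ →
      (grad Ω v : EuclideanSpace ℝ (Fin d) → EuclideanSpace ℝ (Fin d))
      =ᵐ[volume.restrict Ω] (fun x => gradient φ x) → P v) (v : H10 Ω) : P v := by
  -- The test pairs already form a linear subspace, so each element of the span comes from a single
  -- test function.
  have key : ∀ p ∈ Submodule.span ℝ (testPairs Ω), p ∈ testPairs Ω := by
    intro p hp
    induction hp using Submodule.span_induction with
    | mem x hx => exact hx
    | zero =>
      refine ⟨0, contDiff_const, HasCompactSupport.zero, by simp [tsupport], Lp.coeFn_zero _ _ _, ?_⟩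
      filter_upwards [Lp.coeFn_zero (EuclideanSpace ℝ (Fin d)) 2 (volume.restrict Ω)] with x hx
      have : gradient (0 : EuclideanSpace ℝ (Fin d) → ℝ) x = 0 := by
        simp [gradient]
      rw [this]; exact hx
    | add p q _ _ hp hq =>
      obtain ⟨φ, h1, h2, h3, h4, h5⟩ := hp
      obtain ⟨ψ, k1, k2, k3, k4, k5⟩ := hq
      refine ⟨φ + ψ, h1.add k1, h2.add k2, (tsupport_add _ _).trans (union_subset h3 k3), ?_, ?_⟩
      · filter_upwards [Lp.coeFn_add p.fst q.fst, h4, k4] with x hx h4 k4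
        simp only [WithLp.add_fst, hx, Pi.add_apply, h4, k4]
      · filter_upwards [Lp.coeFn_add p.snd q.snd, h5, k5] with x hx h4 k4
        simp only [WithLp.add_snd, hx, Pi.add_apply, h4, k4]
        simp only [gradient]
        rw [fderiv_add (h1.differentiable (by simp) x) (k1.differentiable (by simp) x), map_add]
    | smul a p _ hp =>
      obtain ⟨φ, h1, h2, h3, h4, h5⟩ := hp
      refine ⟨a • φ, contDiff_const.smul h1, h2.smul_left (f := fun _ => a), 
        (tsupport_smul_subset_right (fun _ => a) _).trans h3, ?_, ?_⟩
      · filter_upwards [Lp.coeFn_smul a p.fst, h4] with x hx h4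
        simp only [WithLp.smul_fst, hx, Pi.smul_apply, h4]
      · filter_upwards [Lp.coeFn_smul a p.snd, h5] with x hx h4
        simp only [WithLp.smul_snd, hx, Pi.smul_apply, h4]
        simp only [gradient]
        rw [fderiv_const_smul (h1.differentiable (by simp) x), map_smul]
  obtain ⟨p, hp⟩ := v
  obtain ⟨C, hC, hCP⟩ := isClosed_induced_iff.1 hP
  have hCP' : ∀ q : H10 Ω, (q : WithLp 2 (L2 Ω × L2Vec Ω)) ∈ C ↔ P q := fun q => by
    have := congrArg (q ∈ ·) hCP
    simpa using this
  rw [← hCP']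
  refine closure_minimal ?_ hC hp
  intro q hq
  obtain ⟨φ, h1, h2, h3, h4, h5⟩ := key q hq
  rw [hCP' ⟨q, Submodule.le_topologicalClosure _ hq⟩]
  exact h _ φ h1 h2 h3 h4 h5

theorem norm_sq_H10 (v : H10 Ω) : ‖v‖ ^ 2 = ‖emb Ω v‖ ^ 2 + ‖grad Ω v‖ ^ 2 := by
  exact WithLp.prod_norm_sq_eq_of_L2 (v : WithLp 2 (L2 Ω × L2Vec Ω))

theorem H10.ext {v w : H10 Ω} (h1 : emb Ω v = emb Ω w) (h2 : grad Ω v = grad Ω w) : v = w := by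
  rw [← sub_eq_zero, ← norm_eq_zero, ← sq_eq_zero_iff, norm_sq_H10]
  simp [h1, h2]

/-- The weak gradient is determined by the function. -/
theorem emb_injective (hΩ : IsOpen Ω) : Function.Injective (emb Ω) := by
  intro v w hvw
  refine H10.ext hvw ?_
  suffices h : ∀ v : H10 Ω, emb Ω v = 0 → grad Ω v = 0 by
    have := h (v - w) (by simp [hvw])
    rwa [map_sub, sub_eq_zero] at this
  clear hvw v w
  intro v hv
  -- the weak formulation of the gradient
  have weak : ∀ ψ : EuclideanSpace ℝ (Fin d) → ℝ, ContDiff ℝ ∞ ψ → HasCompactSupport ψ →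
      tsupport ψ ⊆ Ω → ∀ z : EuclideanSpace ℝ (Fin d), ∀ v : H10 Ω,
      ∫ x in Ω, inner ℝ (ψ x • z) (grad Ω v x) = -∫ x in Ω, fderiv ℝ ψ x z * emb Ω v x := by
    intro ψ h1 h2 h3 z v
    have m1 : MemLp (fun x => ψ x • z) 2 (volume.restrict Ω) :=
      ((h1.continuous.smul continuous_const).memLp_of_hasCompactSupport (h2.smul_right (f' := fun _ => z))).restrict _
    have m2 : MemLp (fun x => fderiv ℝ ψ x z) 2 (volume.restrict Ω) :=
      (((h1.continuous_fderiv (by simp)).clm_apply continuous_const).memLp_of_hasCompactSupport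
        (h2.fderiv_apply (𝕜 := ℝ) z)).restrict _
    have e1 : ∀ v : H10 Ω, ∫ x in Ω, inner ℝ (ψ x • z) (grad Ω v x) = inner ℝ m1.toLp (grad Ω v) := by
      intro v
      rw [L2.inner_def]
      refine integral_congr_ae ?_
      filter_upwards [m1.coeFn_toLp] with x hx
      rw [hx]
    have e2 : ∀ v : H10 Ω, ∫ x in Ω, fderiv ℝ ψ x z * emb Ω v x = inner ℝ m2.toLp (emb Ω v) := by
      intro v
      rw [L2.inner_def]
      refine integral_congr_ae ?_
      filter_upwards [m2.coeFn_toLp] with x hx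
      rw [hx]; simp [mul_comm]
    rw [e1, e2]
    -- Both sides are continuous in v, so density leaves the classical integration by parts.
    induction v using H10.induction with
    | hP => exact isClosed_eq (by fun_prop) (by fun_prop)
    | h v φ k1 k2 k3 k4 k5 =>
    rw [← e1, ← e2]
    have a1 : ∫ x in Ω, inner ℝ (ψ x • z) (grad Ω v x) = ∫ x, ψ x * fderiv ℝ φ x z := by
      refine Eq.trans ?_ (setIntegral_eq_integral_of_forall_compl_eq_zero (s := Ω) ?_)
      · refine integral_congr_ae ?_
        filter_upwards [k5] with x hx
        rw [hx, inner_smul_left, real_inner_comm, inner_gradient]; rfl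
      · intro x hx
        rw [image_eq_zero_of_notMem_tsupport (fun h => hx (h3 h)), zero_mul]
    have a2 : ∫ x in Ω, fderiv ℝ ψ x z * emb Ω v x = ∫ x, fderiv ℝ ψ x z * φ x := by
      refine Eq.trans ?_ (setIntegral_eq_integral_of_forall_compl_eq_zero (s := Ω) ?_)
      · refine integral_congr_ae ?_
        filter_upwards [k4] with x hx
        rw [hx]
      · intro x hx
        rw [image_eq_zero_of_notMem_tsupport (fun h => hx (k3 h)), mul_zero]
    rw [a1, a2]
    have cψ : Continuous fun x => fderiv ℝ ψ x z :=
      (h1.continuous_fderiv (by simp)).clm_apply continuous_const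
    have cφ : Continuous fun x => fderiv ℝ φ x z :=
      (k1.continuous_fderiv (by simp)).clm_apply continuous_const
    refine integral_mul_fderiv_eq_neg_fderiv_mul_of_integrable ?_ ?_ ?_
      (fun x _ => h1.differentiable (by simp) x) (fun x _ => k1.differentiable (by simp) x)
    · exact (cψ.mul k1.continuous).integrable_of_hasCompactSupport k2.mul_left
    · exact (h1.continuous.mul cφ).integrable_of_hasCompactSupport h2.mul_right
    · exact (h1.continuous.mul k1.continuous).integrable_of_hasCompactSupport h2.mul_right
  have hloc : LocallyIntegrableOn (grad Ω v) Ω volume := by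
    have : LocallyIntegrable (grad Ω v) (volume.restrict Ω) :=
      (Lp.memLp (grad Ω v)).locallyIntegrable (by norm_num)
    exact locallyIntegrableOn_of_locallyIntegrable_restrict this
  -- As the function vanishes, the weak formulation kills ∫ ψ ∇v · z for every ψ and every direction
  -- z; the fundamental lemma of the calculus of variations applies.
  have := hΩ.ae_eq_zero_of_integral_contDiff_smul_eq_zero hloc (by
    intro ψ h1 h2 h3
    refine ext_inner_left ℝ fun z => ?_
    have hint : Integrable (fun x => ψ x • grad Ω v x) (volume.restrict Ω) := by
      have m1 : MemLp ψ 2 (volume.restrict Ω) := (h1.continuous.memLp_of_hasCompactSupport h2).restrict _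
      exact memLp_one_iff_integrable.1 ((Lp.memLp (grad Ω v)).smul m1)
    rw [← setIntegral_eq_integral_of_forall_compl_eq_zero (s := Ω), ← integral_inner hint,
      inner_zero_right]
    · have w := weak ψ h1 h2 h3 z v
      have : ∫ x in Ω, fderiv ℝ ψ x z * emb Ω v x = 0 := by
        rw [hv]
        refine integral_eq_zero_of_ae ?_
        filter_upwards [Lp.coeFn_zero ℝ 2 (volume.restrict Ω)] with x hx
        simp only [hx, Pi.zero_apply, mul_zero]
      rw [this, neg_zero] at w
      rw [← w]
      refine integral_congr_ae (.of_forall fun x => ?_)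
      simp [inner_smul_left, inner_smul_right]
    · intro x hx
      rw [image_eq_zero_of_notMem_tsupport (fun h => hx (h3 h)), zero_smul])
  refine Lp.ext ?_
  filter_upwards [(ae_restrict_iff' hΩ.measurableSet).2 this,
    Lp.coeFn_zero (EuclideanSpace ℝ (Fin d)) 2 (volume.restrict Ω)] with x h1 h2
  rw [h1, h2]; rfl

/-- This is the density of H¹₀ in L², by the fundamental lemma. It makes 𝒜⁻¹ injective on L², hence
its eigenvalues nonzero. -/
theorem eq_zero_of_forall_inner_emb (hΩ : IsOpen Ω) {g : L2 Ω}
    (h : ∀ v : H10 Ω, inner ℝ g (emb Ω v) = 0) : g = 0 := by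
  have hloc : LocallyIntegrableOn g Ω volume :=
    locallyIntegrableOn_of_locallyIntegrable_restrict
      ((Lp.memLp g).locallyIntegrable (by norm_num))
  have := hΩ.ae_eq_zero_of_integral_contDiff_smul_eq_zero hloc (by
    intro ψ h1 h2 h3
    obtain ⟨v, hv, -⟩ := exists_testPair h1 h2 h3
    rw [← setIntegral_eq_integral_of_forall_compl_eq_zero (s := Ω), ← h v, L2.inner_def]
    · refine integral_congr_ae ?_
      filter_upwards [hv] with x hx
      simp [hx]
    · intro x hx
      rw [image_eq_zero_of_notMem_tsupport (fun h => hx (h3 h)), zero_smul])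
  refine Lp.ext ?_
  filter_upwards [(ae_restrict_iff' hΩ.measurableSet).2 this,
    Lp.coeFn_zero ℝ 2 (volume.restrict Ω)] with x h1 h2
  rw [h1, h2]; rfl

theorem exists_H10_ne_zero (hΩ : IsOpen Ω) (hne : Ω.Nonempty) : ∃ v : H10 Ω, emb Ω v ≠ 0 := by
  by_contra! h
  obtain ⟨x, hx⟩ := hne
  obtain ⟨φ, h1, h2, h3, -, h4⟩ := exists_contDiff_tsupport_subset (n := ⊤) (hΩ.mem_nhds hx)
  obtain ⟨v, hv, -⟩ := exists_testPair h3 h2 h1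
  rw [h v] at hv
  have : φ =ᵐ[volume.restrict Ω] 0 := hv.symm.trans (Lp.coeFn_zero _ _ _)
  have := Measure.eqOn_open_of_ae_eq this hΩ h3.continuous.continuousOn continuousOn_const hx
  simp [h4] at this

/-! ### The Poincaré inequality. -/

theorem norm_emb_sq_eq {φ : EuclideanSpace ℝ (Fin d) → ℝ} (hs : tsupport φ ⊆ Ω) {v : H10 Ω}
    (hv : (emb Ω v : EuclideanSpace ℝ (Fin d) → ℝ) =ᵐ[volume.restrict Ω] φ) :
    ‖emb Ω v‖ ^ 2 = ∫ x, φ x ^ 2 := by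
  rw [← real_inner_self_eq_norm_sq, L2.inner_def]
  refine Eq.trans ?_ (setIntegral_eq_integral_of_forall_compl_eq_zero (s := Ω) ?_)
  · refine integral_congr_ae ?_
    filter_upwards [hv] with x hx
    rw [hx, real_inner_self_eq_norm_sq, Real.norm_eq_abs, sq_abs]
  · intro x hx
    rw [image_eq_zero_of_notMem_tsupport (fun h => hx (hs h)), zero_pow two_ne_zero]

theorem gradient_eq_zero_of_notMem {φ : EuclideanSpace ℝ (Fin d) → ℝ} {x : EuclideanSpace ℝ (Fin d)}
    (hx : x ∉ tsupport φ) : gradient φ x = 0 := by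
  have : fderiv ℝ φ x = 0 := by
    by_contra h
    exact hx (support_fderiv_subset ℝ h)
  simp [gradient, this]

theorem norm_grad_sq_eq {φ : EuclideanSpace ℝ (Fin d) → ℝ} (hs : tsupport φ ⊆ Ω) {v : H10 Ω}
    (hv : (grad Ω v : EuclideanSpace ℝ (Fin d) → EuclideanSpace ℝ (Fin d))
      =ᵐ[volume.restrict Ω] fun x => gradient φ x) :
    ‖grad Ω v‖ ^ 2 = ∫ x, ‖gradient φ x‖ ^ 2 := by
  rw [← real_inner_self_eq_norm_sq, L2.inner_def]
  refine Eq.trans ?_ (setIntegral_eq_integral_of_forall_compl_eq_zero (s := Ω) ?_)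
  · refine integral_congr_ae ?_
    filter_upwards [hv] with x hx
    rw [hx, real_inner_self_eq_norm_sq]
  · intro x hx
    rw [gradient_eq_zero_of_notMem (fun h => hx (hs h)), norm_zero, zero_pow two_ne_zero]

/-- The Poincaré inequality. -/
theorem poincare (hd : 0 < d) (hΩ : Bornology.IsBounded Ω) :
    ∃ C : ℝ, 0 < C ∧ ∀ v : H10 Ω, ‖emb Ω v‖ ^ 2 ≤ C * ‖grad Ω v‖ ^ 2 := by
  obtain ⟨R, hR, hΩR⟩ := hΩ.subset_closedBall_lt 0 0
  -- With p the first coordinate, integration by parts gives ∫φ² = -∫2φ ∂φ p. As |p| ≤ R on Ω, the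
  -- integrand is at most φ²/2 + 2R²|∇φ|²; absorbing the first term leaves the factor 4R².
  refine ⟨4 * R ^ 2, by positivity, fun v => ?_⟩
  induction v using H10.induction with
  | hP => exact isClosed_le (by fun_prop) (by fun_prop)
  | h v φ h1 h2 h3 h4 h5 =>
  rw [norm_emb_sq_eq h3 h4, norm_grad_sq_eq h3 h5]
  set z : EuclideanSpace ℝ (Fin d) := EuclideanSpace.single ⟨0, hd⟩ 1 with hz
  let p : EuclideanSpace ℝ (Fin d) →L[ℝ] ℝ := innerSL ℝ z
  have hpz : p z = 1 := by simp [p, hz]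
  have hzn : ‖z‖ = 1 := by simp [hz]
  have hpx : ∀ x, |p x| ≤ ‖x‖ := fun x => by
    have := abs_real_inner_le_norm z x
    rwa [hzn, one_mul] at this
  have c1 : Continuous fun x => fderiv ℝ φ x z :=
    (h1.continuous_fderiv (by simp)).clm_apply continuous_const
  have cg := continuous_gradient_of_contDiff h1
  have cφ := h1.continuous
  have fd : ∀ x, fderiv ℝ (fun x => φ x ^ 2) x z = 2 * φ x * fderiv ℝ φ x z := fun x => by
    have := (h1.differentiable (by simp) x).hasFDerivAt.pow 2
    rw [this.fderiv]; simp
  have hc2 : HasCompactSupport fun x => φ x ^ 2 := h2.comp_left (g := fun y => y ^ 2) (by simp)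
  have hg2 : HasCompactSupport fun x => ‖gradient φ x‖ ^ 2 :=
    (HasCompactSupport.gradient' h2).comp_left (g := fun y => ‖y‖ ^ 2) (by simp)
  have hc3 : HasCompactSupport fun x => 2 * φ x * fderiv ℝ φ x z :=
    HasCompactSupport.mul_right (HasCompactSupport.mul_left h2)
  have ibp := integral_mul_fderiv_eq_neg_fderiv_mul_of_integrable (μ := volume) (v := z)
    (f := fun x => φ x ^ 2) (g := p) ?_ ?_ ?_
    (fun x _ => ((h1.pow 2).differentiable (by simp) x)) (fun x _ => p.differentiableAt)
  · simp only [fd, ContinuousLinearMap.fderiv, hpz, mul_one] at ibp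
    have i1 : Integrable (fun x => φ x ^ 2) := (cφ.pow 2).integrable_of_hasCompactSupport hc2
    have i2 : Integrable (fun x => ‖gradient φ x‖ ^ 2) :=
      (cg.norm.pow 2).integrable_of_hasCompactSupport hg2
    have i3 : Integrable (fun x => 2 * φ x * fderiv ℝ φ x z * p x) :=
      (((continuous_const.mul cφ).mul c1).mul p.continuous).integrable_of_hasCompactSupport
        hc3.mul_right
    have key : ∫ x, -(2 * φ x * fderiv ℝ φ x z * p x) ≤
        ∫ x, ((1 / 2) * φ x ^ 2 + (2 * R ^ 2) * ‖gradient φ x‖ ^ 2) := by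
      refine integral_mono i3.neg ((i1.const_mul _).add (i2.const_mul _)) fun x => ?_
      by_cases hx : x ∈ tsupport φ
      · have b1 : |p x| ≤ R := (hpx x).trans (by simpa using hΩR (h3 hx))
        have b2 : |fderiv ℝ φ x z| ≤ ‖gradient φ x‖ := by
          rw [← inner_gradient]
          have := abs_real_inner_le_norm (gradient φ x) z
          rwa [hzn, mul_one] at this
        have b3 : |fderiv ℝ φ x z * p x| ≤ ‖gradient φ x‖ * R := by
          rw [abs_mul]; gcongr
        have b4 : (fderiv ℝ φ x z * p x) ^ 2 ≤ (‖gradient φ x‖ * R) ^ 2 := by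
          rw [← sq_abs]; gcongr
        simp only
        nlinarith [sq_nonneg (φ x + 2 * (fderiv ℝ φ x z * p x))]
      · simp [image_eq_zero_of_notMem_tsupport hx]
        positivity
    rw [integral_neg, ← ibp, integral_add (i1.const_mul _) (i2.const_mul _), integral_const_mul,
      integral_const_mul] at key
    linarith
  · simp only [fd]
    exact (((continuous_const.mul cφ).mul c1).mul p.continuous).integrable_of_hasCompactSupport
        hc3.mul_right
  · simp only [ContinuousLinearMap.fderiv, hpz, mul_one]
    exact (cφ.pow 2).integrable_of_hasCompactSupport hc2
  · exact ((cφ.pow 2).mul p.continuous).integrable_of_hasCompactSupport hc2.mul_right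

/-! ### The Dirichlet Laplacian and its inverse. -/

instance : CompleteSpace (H10 Ω) :=
  (Submodule.isClosed_topologicalClosure _).completeSpace_coe

@[simp] theorem opA_apply (v w : H10 Ω) : opA Ω v w = inner ℝ (grad Ω v) (grad Ω w) := rfl

@[simp] theorem embDual_apply (g : L2 Ω) (w : H10 Ω) : embDual Ω g w = inner ℝ g (emb Ω w) := rfl

/-- Lax-Milgram: by Poincaré the gradient form is coercive for the full H¹ norm, with constant 1/(C
+ 1). Invertibility ensures that `ContinuousLinearMap.inverse` is not its default value 0. -/
theorem opA_isInvertible (hd : 0 < d) (hΩ : Bornology.IsBounded Ω) : (opA Ω).IsInvertible := by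
  obtain ⟨C, hC, hP⟩ := poincare hd hΩ
  have co : IsCoercive (opA Ω) := by
    refine ⟨(C + 1)⁻¹, by positivity, fun v => ?_⟩
    rw [opA_apply, real_inner_self_eq_norm_sq, mul_assoc, ← sq, inv_mul_le_iff₀ (by positivity),
      norm_sq_H10]
    linarith [hP v]
  refine ⟨co.continuousLinearEquivOfBilin.trans
    (InnerProductSpace.toDual ℝ (H10 Ω)).toContinuousLinearEquiv, ?_⟩
  ext v w
  have := co.continuousLinearEquivOfBilin_apply v w
  simpa using this

theorem opA_invA (hd : 0 < d) (hΩ : Bornology.IsBounded Ω) (f : Hm1 Ω) : opA Ω (invA Ω f) = f :=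
  (opA_isInvertible hd hΩ).self_apply_inverse f

theorem invA_opA (hd : 0 < d) (hΩ : Bornology.IsBounded Ω) (v : H10 Ω) : invA Ω (opA Ω v) = v :=
  (opA_isInvertible hd hΩ).inverse_apply_self v

theorem inner_grad_invA (hd : 0 < d) (hΩ : Bornology.IsBounded Ω) (f : Hm1 Ω) (v : H10 Ω) :
    inner ℝ (grad Ω (invA Ω f)) (grad Ω v) = f v := by
  rw [← opA_apply, opA_invA hd hΩ]

theorem inner_grad_invAL2 (hd : 0 < d) (hΩ : Bornology.IsBounded Ω) (g : L2 Ω) (v : H10 Ω) :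
    inner ℝ (grad Ω (invAL2 Ω g)) (grad Ω v) = inner ℝ g (emb Ω v) :=
  inner_grad_invA hd hΩ _ v

/-! ### Compactness of the embedding -/

/-- Cauchy-Schwarz against the constant 1, read off from ∫(Vf - m)² ≥ 0 with V the total mass and m
= ∫f. -/
theorem sq_integral_le_measureReal_mul {α : Type*} [MeasurableSpace α] {μ : Measure α}
    [IsFiniteMeasure μ] {f : α → ℝ} (hf : Integrable f μ) (hf2 : Integrable (fun x => f x ^ 2) μ) :
    (∫ x, f x ∂μ) ^ 2 ≤ μ.real univ * ∫ x, f x ^ 2 ∂μ := by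
  rcases eq_or_ne μ 0 with rfl | hμ
  · simp
  set m := ∫ x, f x ∂μ with hm
  set V := μ.real univ with hV
  have hVpos : 0 < V := by
    rw [hV, measureReal_def, ENNReal.toReal_pos_iff]
    exact ⟨Measure.measure_univ_pos.2 hμ, measure_lt_top _ _⟩
  have h0 : 0 ≤ ∫ x, (V * f x - m) ^ 2 ∂μ := integral_nonneg fun x => sq_nonneg _
  have h1 : ∫ x, (V * f x - m) ^ 2 ∂μ
      = V ^ 2 * ∫ x, f x ^ 2 ∂μ - 2 * V * m * m + m ^ 2 * V := by
    have : ∀ x, (V * f x - m) ^ 2 = V ^ 2 * f x ^ 2 - 2 * V * m * f x + m ^ 2 := fun x => by ring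
    simp only [this]
    rw [integral_add, integral_sub, integral_const_mul, integral_const_mul, integral_const,
      smul_eq_mul]
    · ring
    · exact hf2.const_mul _
    · exact hf.const_mul _
    · exact (hf2.const_mul _).sub (hf.const_mul _)
    · exact integrable_const _
  rw [h1] at h0
  have : 0 ≤ V * (V * ∫ x, f x ^ 2 ∂μ - m ^ 2) := by nlinarith
  nlinarith [nonneg_of_mul_nonneg_right this hVpos]

/-- The difference is the integral of ∂_zφ along the segment from x to x + z. Cauchy-Schwarz in the
segment parameter, Tonelli and translation invariance give the bound. -/
theorem lintegral_sq_translate_sub_le {φ : EuclideanSpace ℝ (Fin d) → ℝ} (h : ContDiff ℝ ∞ φ)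
    (z : EuclideanSpace ℝ (Fin d)) :
    ∫⁻ x, ENNReal.ofReal ((φ (x + z) - φ x) ^ 2) ≤
      ENNReal.ofReal (‖z‖ ^ 2) * ∫⁻ x, ENNReal.ofReal (‖gradient φ x‖ ^ 2) := by
  have cg := continuous_gradient_of_contDiff h
  have hpt : ∀ x, ENNReal.ofReal ((φ (x + z) - φ x) ^ 2) ≤
      ∫⁻ s in Ioc (0 : ℝ) 1, ENNReal.ofReal (‖z‖ ^ 2 * ‖gradient φ (x + s • z)‖ ^ 2) := by
    intro x
    have cD : Continuous fun s : ℝ => fderiv ℝ φ (x + s • z) z := by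
      have := h.continuous_fderiv (by simp)
      fun_prop
    have e1 : φ (x + z) - φ x = ∫ s in Ioc (0 : ℝ) 1, fderiv ℝ φ (x + s • z) z := by
      rw [← intervalIntegral.integral_of_le zero_le_one,
        intervalIntegral.integral_eq_sub_of_hasDerivAt (f := fun s : ℝ => φ (x + s • z))]
      · simp
      · intro s _
        have h2 : HasDerivAt (fun s : ℝ => x + s • z) z s := by
          simpa using ((hasDerivAt_id s).smul_const z).const_add x
        exact (h.differentiable (by simp) _).hasFDerivAt.comp_hasDerivAt s h2
      · exact cD.intervalIntegrable _ _
    have i1 : IntegrableOn (fun s : ℝ => fderiv ℝ φ (x + s • z) z) (Ioc 0 1) :=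
      (cD.integrableOn_Icc (a := 0) (b := 1)).mono_set Ioc_subset_Icc_self
    have i2 : IntegrableOn (fun s : ℝ => (fderiv ℝ φ (x + s • z) z) ^ 2) (Ioc 0 1) :=
      ((cD.pow 2).integrableOn_Icc (a := 0) (b := 1)).mono_set Ioc_subset_Icc_self
    have i3 : IntegrableOn (fun s : ℝ => ‖z‖ ^ 2 * ‖gradient φ (x + s • z)‖ ^ 2) (Ioc 0 1) := by
      have c : Continuous (fun s : ℝ => ‖z‖ ^ 2 * ‖gradient φ (x + s • z)‖ ^ 2) := by fun_prop
      exact (c.integrableOn_Icc (a := 0) (b := 1)).mono_set Ioc_subset_Icc_self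
    rw [← ofReal_integral_eq_lintegral_ofReal i3 (.of_forall fun s => by positivity)]
    refine ENNReal.ofReal_le_ofReal ?_
    rw [e1]
    refine (sq_integral_le_measureReal_mul i1 i2).trans ?_
    have : (volume.restrict (Ioc (0 : ℝ) 1)).real univ = 1 := by simp [measureReal_def]
    rw [this, one_mul]
    refine integral_mono i2 i3 fun s => ?_
    simp only
    rw [← inner_gradient, ← sq_abs, ← mul_pow, mul_comm ‖z‖]
    have := abs_real_inner_le_norm (gradient φ (x + s • z)) z
    gcongr
  calc ∫⁻ x, ENNReal.ofReal ((φ (x + z) - φ x) ^ 2)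
      ≤ ∫⁻ x, ∫⁻ s in Ioc (0 : ℝ) 1, ENNReal.ofReal (‖z‖ ^ 2 * ‖gradient φ (x + s • z)‖ ^ 2) :=
        lintegral_mono hpt
    _ = ∫⁻ s in Ioc (0 : ℝ) 1, ∫⁻ x, ENNReal.ofReal (‖z‖ ^ 2 * ‖gradient φ (x + s • z)‖ ^ 2) := by
        refine lintegral_lintegral_swap (Continuous.aemeasurable ?_)
        exact ENNReal.continuous_ofReal.comp (by fun_prop)
    _ = ∫⁻ s in Ioc (0 : ℝ) 1, ENNReal.ofReal (‖z‖ ^ 2) *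
          ∫⁻ x, ENNReal.ofReal (‖gradient φ x‖ ^ 2) := by
        congr 1 with s
        simp only [ENNReal.ofReal_mul (sq_nonneg ‖z‖)]
        rw [lintegral_const_mul]
        · rw [lintegral_add_right_eq_self (μ := volume)
            (fun x => ENNReal.ofReal (‖gradient φ x‖ ^ 2)) (s • z)]
        · exact (ENNReal.continuous_ofReal.comp (by fun_prop)).measurable
    _ = _ := by simp

/-- The cell of index `k` of the cubic grid of side `h`. -/
def gridCell (h : ℝ) (k : Fin d → ℤ) : Set (EuclideanSpace ℝ (Fin d)) :=
  {y | ∀ i, ⌊y i / h⌋ = k i}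

/-- The index of the cell that contains `x`. -/
def gridIndex (h : ℝ) (x : EuclideanSpace ℝ (Fin d)) : Fin d → ℤ := fun i => ⌊x i / h⌋

theorem mem_gridCell {h : ℝ} {k : Fin d → ℤ} {x : EuclideanSpace ℝ (Fin d)} :
    x ∈ gridCell h k ↔ k = gridIndex h x := by
  simp only [gridCell, mem_ofPred_eq, gridIndex, funext_iff, eq_comm]

theorem gridCell_eq_preimage {h : ℝ} (hh : 0 < h) (k : Fin d → ℤ) :
    gridCell h k = WithLp.ofLp ⁻¹' Set.univ.pi fun i => Ico (k i * h) ((k i + 1) * h) := by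
  ext y
  simp only [gridCell, mem_ofPred_eq, mem_preimage, mem_univ_pi, mem_Ico, Int.floor_eq_iff]
  refine forall_congr' fun i => ?_
  rw [le_div_iff₀ hh, div_lt_iff₀ hh]

theorem measurableSet_gridCell {h : ℝ} (hh : 0 < h) (k : Fin d → ℤ) :
    MeasurableSet (gridCell h k) := by
  rw [gridCell_eq_preimage hh]
  exact (PiLp.volume_preserving_ofLp (Fin d)).measurable
    (MeasurableSet.univ_pi fun i => measurableSet_Ico)

theorem volume_gridCell {h : ℝ} (hh : 0 < h) (k : Fin d → ℤ) :
    volume (gridCell h k) = ENNReal.ofReal (h ^ d) := by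
  rw [gridCell_eq_preimage hh, (PiLp.volume_preserving_ofLp (Fin d)).measure_preimage
    (MeasurableSet.univ_pi fun i => measurableSet_Ico).nullMeasurableSet, Real.volume_pi_Ico]
  have : ∀ i, ((k i : ℝ) + 1) * h - k i * h = h := fun i => by ring
  simp [this, ENNReal.ofReal_pow hh.le]

theorem gridCell_subset_closedBall {h : ℝ} (hh : 0 < h) (x : EuclideanSpace ℝ (Fin d)) :
    gridCell h (gridIndex h x) ⊆ Metric.closedBall x (√d * h) := by
  intro y hy
  have hx : x ∈ gridCell h (gridIndex h x) := mem_gridCell.2 rfl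
  rw [gridCell_eq_preimage hh] at hx hy
  simp only [mem_preimage, mem_univ_pi, mem_Ico] at hx hy
  rw [Metric.mem_closedBall, EuclideanSpace.dist_eq]
  refine Real.sqrt_le_iff.2 ⟨by positivity, ?_⟩
  rw [mul_pow, Real.sq_sqrt (by positivity)]
  calc ∑ i, dist (y.ofLp i) (x.ofLp i) ^ 2 ≤ ∑ i : Fin d, h ^ 2 := by
        refine Finset.sum_le_sum fun i _ => ?_
        have := hx i
        have := hy i
        gcongr
        rw [Real.dist_eq, abs_le]
        constructor <;> linarith
    _ = d * h ^ 2 := by simp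

/-- The indicator function of a cell, as an element of `L²(Ω)`. -/
def cellIndicator (Ω : Set (EuclideanSpace ℝ (Fin d))) {h : ℝ} (hh : 0 < h) (k : Fin d → ℤ) :
    L2 Ω :=
  indicatorConstLp 2 (μ := volume.restrict Ω) (measurableSet_gridCell hh k)
    (((Measure.restrict_apply_le _ _).trans_lt (by
      rw [volume_gridCell hh]; exact ENNReal.ofReal_lt_top)).ne) (1 : ℝ)

/-- Averaging over the cells of the grid with index in `F`. -/
def cellAverage (Ω : Set (EuclideanSpace ℝ (Fin d))) {h : ℝ} (hh : 0 < h)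
    (F : Finset (Fin d → ℤ)) : L2 Ω →L[ℝ] L2 Ω :=
  ∑ k ∈ F, (h ^ d)⁻¹ • (innerSL ℝ (cellIndicator Ω hh k)).smulRight (cellIndicator Ω hh k)

theorem isCompactOperator_cellAverage {h : ℝ} (hh : 0 < h) (F : Finset (Fin d → ℤ)) :
    IsCompactOperator (cellAverage Ω hh F) := by
  have : cellAverage Ω hh F ∈ compactOperator (RingHom.id ℝ) (L2 Ω) (L2 Ω) := by
    refine Submodule.sum_mem _ fun k _ => Submodule.smul_mem _ _ ?_
    change IsCompactOperator _
    exact (isCompactOperator_of_locallyCompactSpace_rng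
      (ContinuousLinearMap.toSpanSingleton ℝ (cellIndicator Ω hh k))).comp_clm
      (innerSL ℝ (cellIndicator Ω hh k))
  exact this

/-- Only the cell that contains x contributes at x. The divisor is the volume of the whole cell even
if the cell leaves Ω; this suits functions extended by zero. -/
theorem cellAverage_ae_eq {h : ℝ} (hh : 0 < h) (F : Finset (Fin d → ℤ))
    (hF : ∀ x ∈ Ω, gridIndex h x ∈ F) (hΩ : MeasurableSet Ω) (f : L2 Ω) :
    ∀ᵐ x ∂(volume.restrict Ω), cellAverage Ω hh F f x =
      (h ^ d)⁻¹ * ∫ y in gridCell h (gridIndex h x), f y ∂(volume.restrict Ω) := by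
  have e : cellAverage Ω hh F f = ∑ k ∈ F, ((h ^ d)⁻¹ *
      ∫ y in gridCell h k, f y ∂(volume.restrict Ω)) • cellIndicator Ω hh k := by
    simp only [cellAverage, sum_apply]
    refine Finset.sum_congr rfl fun k _ => ?_
    simp [cellIndicator, L2.inner_indicatorConstLp_one, smul_smul]
  rw [e]
  have h2 : ∀ k ∈ F, ∀ᵐ x ∂(volume.restrict Ω),
      (((h ^ d)⁻¹ * ∫ y in gridCell h k, f y ∂(volume.restrict Ω)) • cellIndicator Ω hh k : L2 Ω) x
      = if k = gridIndex h x then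
        ((h ^ d)⁻¹ * ∫ y in gridCell h k, f y ∂(volume.restrict Ω)) else 0 := by
    intro k _
    filter_upwards [Lp.coeFn_smul ((h ^ d)⁻¹ * ∫ y in gridCell h k, f y ∂(volume.restrict Ω))
      (cellIndicator Ω hh k), indicatorConstLp_coeFn (μ := volume.restrict Ω) (p := 2)
        (hs := measurableSet_gridCell hh k) (c := (1 : ℝ)) (hμs := 
        (((Measure.restrict_apply_le _ _).trans_lt (by
      rw [volume_gridCell hh]; exact ENNReal.ofReal_lt_top)).ne))] with x hx1 hx2
    rw [hx1, Pi.smul_apply, cellIndicator, hx2]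
    by_cases hk : x ∈ gridCell h k
    · simp [hk, ← mem_gridCell]
    · simp [hk, ← mem_gridCell]
  have h3 := (F.eventually_all (l := ae (volume.restrict Ω))).2 h2
  filter_upwards [Lp.coeFn_fun_finsetSum F fun k => (((h ^ d)⁻¹ *
      ∫ y in gridCell h k, f y ∂(volume.restrict Ω)) • cellIndicator Ω hh k : L2 Ω), h3,
      ae_restrict_mem hΩ] with x hx1 hx2 hxΩ
  rw [hx1, Finset.sum_congr rfl hx2, Finset.sum_ite_eq' F (gridIndex h x), if_pos (hF x hxΩ)]

theorem exists_finset_gridIndex_mem (hΩ : Bornology.IsBounded Ω) {h : ℝ} (hh : 0 < h) :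
    ∃ F : Finset (Fin d → ℤ), ∀ x ∈ Ω, gridIndex h x ∈ F := by
  obtain ⟨R, hR, hΩR⟩ := hΩ.subset_closedBall_lt 0 0
  refine ⟨Fintype.piFinset fun _ => Finset.Icc ⌊-R / h⌋ ⌊R / h⌋, fun x hx => ?_⟩
  rw [Fintype.mem_piFinset]
  intro i
  have h1 : |x i| ≤ R := by
    have h2 : ‖x‖ ≤ R := by simpa using hΩR hx
    exact (PiLp.norm_apply_le x i).trans h2
  rw [abs_le] at h1
  rw [Finset.mem_Icc]
  constructor <;> (refine Int.floor_le_floor ?_; gcongr; linarith)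

/-- The error is an average of the differences φ(y) - φ(x) over the cell. After Cauchy-Schwarz the
cell is enlarged to a ball about x, so that the range of z = y - x no longer depends on x and
Tonelli can be used next. -/
theorem sub_cellAverage_sq_le (hΩ : MeasurableSet Ω) {h : ℝ} (hh : 0 < h)
    (F : Finset (Fin d → ℤ)) (hF : ∀ x ∈ Ω, gridIndex h x ∈ F) {v : H10 Ω}
    {φ : EuclideanSpace ℝ (Fin d) → ℝ} (h1 : ContDiff ℝ ∞ φ) (h2 : HasCompactSupport φ)
    (h3 : tsupport φ ⊆ Ω)
    (h4 : (emb Ω v : EuclideanSpace ℝ (Fin d) → ℝ) =ᵐ[volume.restrict Ω] φ) :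
    ∀ᵐ x ∂(volume.restrict Ω),
      ENNReal.ofReal ((emb Ω v - cellAverage Ω hh F (emb Ω v) : L2 Ω) x ^ 2) ≤
      ENNReal.ofReal ((h ^ d)⁻¹) * ∫⁻ z in
        Metric.closedBall (0 : EuclideanSpace ℝ (Fin d)) (√d * h),
        ENNReal.ofReal ((φ (x + z) - φ x) ^ 2) := by
  set R := √d * h with hR
  have cφ := h1.continuous
  have hint : Integrable φ := cφ.integrable_of_hasCompactSupport h2
  have hmass (x : EuclideanSpace ℝ (Fin d)) :
      (volume.restrict (gridCell h (gridIndex h x))).real univ = h ^ d := by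
    rw [measureReal_def, Measure.restrict_apply_univ, volume_gridCell hh,
      ENNReal.toReal_ofReal (by positivity)]
  have hfin (x : EuclideanSpace ℝ (Fin d)) :
      IsFiniteMeasure (volume.restrict (gridCell h (gridIndex h x))) :=
    ⟨by rw [Measure.restrict_apply_univ, volume_gridCell hh]; exact ENNReal.ofReal_lt_top⟩
  filter_upwards [Lp.coeFn_sub (emb Ω v) (cellAverage Ω hh F (emb Ω v)), h4,
    cellAverage_ae_eq hh F hF hΩ (emb Ω v)] with x hx1 hx2 hx3
  have := hfin x
  -- Since φ vanishes off Ω, cutting the cell by Ω does not change the integral.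
  have e1 : ∫ y in gridCell h (gridIndex h x), emb Ω v y ∂(volume.restrict Ω) =
      ∫ y in gridCell h (gridIndex h x), φ y := by
    rw [integral_congr_ae (ae_restrict_of_ae h4),
      Measure.restrict_restrict (measurableSet_gridCell hh _), inter_comm,
      ← Measure.restrict_restrict hΩ]
    exact setIntegral_eq_integral_of_forall_compl_eq_zero fun y hy =>
      image_eq_zero_of_notMem_tsupport fun hy' => hy (h3 hy')
  have e2 : (emb Ω v - cellAverage Ω hh F (emb Ω v) : L2 Ω) x =
      -((h ^ d)⁻¹ * ∫ y in gridCell h (gridIndex h x), (φ y - φ x)) := by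
    rw [hx1, Pi.sub_apply, hx2, hx3, e1, integral_sub hint.integrableOn (integrable_const _),
      integral_const, hmass, smul_eq_mul]
    field_simp
    ring
  have c3 : Continuous fun y => (φ y - φ x) ^ 2 := by fun_prop
  have i3 : IntegrableOn (fun y => (φ y - φ x) ^ 2) (gridCell h (gridIndex h x)) :=
    (c3.continuousOn.integrableOn_compact (isCompact_closedBall x R)).mono_set
      (gridCell_subset_closedBall hh x)
  have e3 : ((h ^ d)⁻¹ * ∫ y in gridCell h (gridIndex h x), (φ y - φ x)) ^ 2 ≤
      (h ^ d)⁻¹ * ∫ y in gridCell h (gridIndex h x), (φ y - φ x) ^ 2 := by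
    have := sq_integral_le_measureReal_mul (μ := volume.restrict (gridCell h (gridIndex h x)))
      (f := fun y => φ y - φ x) (hint.integrableOn.sub (integrable_const _)) i3
    rw [hmass] at this
    rw [mul_pow]
    calc _ ≤ (h ^ d)⁻¹ ^ 2 * (h ^ d * ∫ y in gridCell h (gridIndex h x), (φ y - φ x) ^ 2) := by
          gcongr
      _ = _ := by field_simp
  rw [e2, neg_sq]
  refine (ENNReal.ofReal_le_ofReal e3).trans ?_
  rw [ENNReal.ofReal_mul (by positivity),
    ofReal_integral_eq_lintegral_ofReal i3 (.of_forall fun s => by positivity)]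
  refine mul_le_mul' le_rfl ?_
  calc ∫⁻ y in gridCell h (gridIndex h x), ENNReal.ofReal ((φ y - φ x) ^ 2)
      ≤ ∫⁻ y in Metric.closedBall x R, ENNReal.ofReal ((φ y - φ x) ^ 2) :=
        lintegral_mono_set (gridCell_subset_closedBall hh x)
    _ = ∫⁻ y, (Metric.closedBall x R).indicator
          (fun y => ENNReal.ofReal ((φ y - φ x) ^ 2)) y := by
        rw [lintegral_indicator Metric.isClosed_closedBall.measurableSet]
    _ = ∫⁻ z, (Metric.closedBall x R).indicator
          (fun y => ENNReal.ofReal ((φ y - φ x) ^ 2)) (x + z) :=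
        (lintegral_add_left_eq_self (μ := volume) _ x).symm
    _ = ∫⁻ z, (Metric.closedBall (0 : EuclideanSpace ℝ (Fin d)) R).indicator
          (fun z => ENNReal.ofReal ((φ (x + z) - φ x) ^ 2)) z := by
        congr 1 with z
        simp only [indicator, Metric.mem_closedBall, dist_self_add_left, dist_zero_right]
    _ = _ := by rw [lintegral_indicator Metric.isClosed_closedBall.measurableSet]
theorem ofReal_norm_sq_L2 (w : L2 Ω) :
    ENNReal.ofReal (‖w‖ ^ 2) = ∫⁻ x in Ω, ENNReal.ofReal (w x ^ 2) := by
  rw [← real_inner_self_eq_norm_sq, L2.inner_def,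
    ofReal_integral_eq_lintegral_ofReal (L2.integrable_inner w w)
      (.of_forall fun x => real_inner_self_nonneg)]
  simp only [real_inner_self_eq_norm_sq, Real.norm_eq_abs, sq_abs]

theorem integrable_norm_gradient_sq {φ : EuclideanSpace ℝ (Fin d) → ℝ} (h : ContDiff ℝ ∞ φ)
    (hc : HasCompactSupport φ) : Integrable fun x => ‖gradient φ x‖ ^ 2 := by
  have h1 : HasCompactSupport fun x => ‖gradient φ x‖ ^ 2 :=
    (HasCompactSupport.gradient' hc).comp_left (g := fun y => ‖y‖ ^ 2) (by simp)
  have h2 := continuous_gradient_of_contDiff h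
  exact (h2.norm.pow 2).integrable_of_hasCompactSupport h1

/-- Cell averages approximate the embedding of `H¹₀(Ω)` into `L²(Ω)`. -/
theorem norm_sub_cellAverage_sq_le (hΩ : MeasurableSet Ω) {h : ℝ} (hh : 0 < h)
    (F : Finset (Fin d → ℤ)) (hF : ∀ x ∈ Ω, gridIndex h x ∈ F) (v : H10 Ω) :
    ‖emb Ω v - cellAverage Ω hh F (emb Ω v)‖ ^ 2 ≤
      (√d ^ d * d * volume.real (Metric.ball (0 : EuclideanSpace ℝ (Fin d)) 1)) * h ^ 2
        * ‖grad Ω v‖ ^ 2 := by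
  induction v using H10.induction with
  | hP => exact isClosed_le (by fun_prop) (by fun_prop)
  | h v φ h1 h2 h3 h4 h5 =>
  set R := √d * h with hR
  have hR0 : 0 ≤ R := by positivity
  have cφ := h1.continuous
  have hpt := sub_cellAverage_sq_le hΩ hh F hF h1 h2 h3 h4
  rw [← hR] at hpt
  have hD : ∫⁻ x, ENNReal.ofReal (‖gradient φ x‖ ^ 2) = ENNReal.ofReal (‖grad Ω v‖ ^ 2) := by
    rw [norm_grad_sq_eq h3 h5, ofReal_integral_eq_lintegral_ofReal]
    · exact integrable_norm_gradient_sq h1 h2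
    · exact .of_forall fun x => by positivity
  set w := emb Ω v - cellAverage Ω hh F (emb Ω v) with hw
  refine (ENNReal.ofReal_le_ofReal_iff (by positivity)).1 ?_
  rw [ofReal_norm_sq_L2]
  -- After Tonelli each translation by z costs at most R²‖∇φ‖², and the ball of the z has volume
  -- R^d|B₁|. With R = √d h the factor h^{-d}R^{d+2} becomes √d^d · d · h².
  calc ∫⁻ x in Ω, ENNReal.ofReal (w x ^ 2)
      ≤ ∫⁻ x in Ω, ENNReal.ofReal ((h ^ d)⁻¹) *
          ∫⁻ z in Metric.closedBall (0 : EuclideanSpace ℝ (Fin d)) R,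
          ENNReal.ofReal ((φ (x + z) - φ x) ^ 2) := lintegral_mono_ae hpt
    _ ≤ ∫⁻ x, ENNReal.ofReal ((h ^ d)⁻¹) *
          ∫⁻ z in Metric.closedBall (0 : EuclideanSpace ℝ (Fin d)) R,
          ENNReal.ofReal ((φ (x + z) - φ x) ^ 2) := setLIntegral_le_lintegral _ _
    _ = ENNReal.ofReal ((h ^ d)⁻¹) *
          ∫⁻ z in Metric.closedBall (0 : EuclideanSpace ℝ (Fin d)) R, ∫⁻ x,
          ENNReal.ofReal ((φ (x + z) - φ x) ^ 2) := by
        rw [lintegral_const_mul' _ _ ENNReal.ofReal_ne_top, lintegral_lintegral_swap]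
        exact (ENNReal.continuous_ofReal.comp (by fun_prop)).aemeasurable
    _ ≤ ENNReal.ofReal ((h ^ d)⁻¹) *
          ∫⁻ z in Metric.closedBall (0 : EuclideanSpace ℝ (Fin d)) R,
          ENNReal.ofReal (R ^ 2) * ENNReal.ofReal (‖grad Ω v‖ ^ 2) := by
        gcongr 1
        refine setLIntegral_mono measurable_const fun z hz => ?_
        refine (lintegral_sq_translate_sub_le h1 z).trans ?_
        rw [hD]
        have : ‖z‖ ≤ R := by simpa using hz
        gcongr
    _ = _ := by
        rw [setLIntegral_const, Measure.addHaar_closedBall volume _ hR0,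
          ← ENNReal.ofReal_mul (by positivity), ← ofReal_measureReal (by finiteness),
          ← ENNReal.ofReal_mul (by positivity), ← ENNReal.ofReal_mul (by positivity),
          ← ENNReal.ofReal_mul (by positivity)]
        congr 1
        rw [finrank_euclideanSpace_fin, hR,
          mul_pow, mul_pow, Real.sq_sqrt (by positivity)]
        field_simp

/-- The Rellich theorem: `H¹₀(Ω)` is compactly embedded into `L²(Ω)`. -/
theorem isCompactOperator_emb (hΩ : MeasurableSet Ω) (hb : Bornology.IsBounded Ω) :
    IsCompactOperator (emb Ω) := by
  have hh : ∀ n : ℕ, (0 : ℝ) < 1 / (n + 1) := fun n => by positivity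
  choose F hF using fun n : ℕ => exists_finset_gridIndex_mem hb (hh n)
  -- The embedding is the limit in operator norm, with rate √K/(n + 1), of operators of finite rank:
  -- averages over cells of side 1/(n + 1).
  refine isCompactOperator_of_tendsto (l := Filter.atTop)
    (F := fun n => (cellAverage Ω (hh n) (F n)).comp (emb Ω)) ?_
    (.of_forall fun n => (isCompactOperator_cellAverage (hh n) (F n)).comp_clm _)
  set K : ℝ := √d ^ d * d * volume.real (Metric.ball (0 : EuclideanSpace ℝ (Fin d)) 1)
  have hK : 0 ≤ K := by positivity
  refine (tendsto_iff_norm_sub_tendsto_zero (E := H10 Ω →L[ℝ] L2 Ω)).2 ?_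
  refine squeeze_zero (fun _ => norm_nonneg (E := H10 Ω →L[ℝ] L2 Ω) _) (g := fun n : ℕ => √K * (1 / (n + 1))) (fun n => ?_)
    (by simpa using tendsto_one_div_add_atTop_nhds_zero_nat.const_mul (√K))
  refine ContinuousLinearMap.opNorm_le_bound _ (by positivity) fun v => ?_
  rw [show ‖((cellAverage Ω (hh n) (F n)).comp (emb Ω) - emb Ω) v‖ =
    ‖emb Ω v - cellAverage Ω (hh n) (F n) (emb Ω v)‖ from norm_sub_rev _ _]
  refine abs_le_of_sq_le_sq' ?_ (by positivity) |>.2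
  refine (norm_sub_cellAverage_sq_le hΩ (hh n) (F n) (hF n) v).trans ?_
  rw [mul_pow, mul_pow, Real.sq_sqrt hK]
  gcongr
  rw [← sq_le_sq₀ (norm_nonneg _) (norm_nonneg _), norm_sq_H10 v]
  nlinarith [sq_nonneg ‖emb Ω v‖]

/-! ### The eigenbasis of the Dirichlet Laplacian -/

/-- A Hilbert basis of `L²(Ω)` that consists of eigenfunctions of the Dirichlet Laplacian. -/
structure DirichletBasis (Ω : Set (EuclideanSpace ℝ (Fin d))) where
  ι : Type
  e : HilbertBasis ι ℝ (L2 Ω)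
  lam : ι → ℝ
  w : ι → H10 Ω
  lam_pos : ∀ k, 0 < lam k
  emb_w : ∀ k, emb Ω (w k) = e k
  inner_w : ∀ k v, inner ℝ (grad Ω (w k)) (grad Ω v) = lam k * inner ℝ (e k) (emb Ω v)

/-- The eigenspaces of a compact symmetric operator are mutually orthogonal and together span a
dense subspace, so Hilbert bases of all of them are glued. The index runs over every real μ; a
trivial eigenspace contributes nothing. -/
theorem exists_eigenvector_hilbertBasis {E : Type} [NormedAddCommGroup E] [InnerProductSpace ℝ E]
    [CompleteSpace E] {K : E →L[ℝ] E} (hc : IsCompactOperator K)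
    (hs : (K : E →ₗ[ℝ] E).IsSymmetric) :
    ∃ (ι : Type) (e : HilbertBasis ι ℝ E) (μ : ι → ℝ), ∀ k, K (e k) = μ k • e k := by
  let V : ℝ → Submodule ℝ E := fun μ => Module.End.eigenspace (K : E →ₗ[ℝ] E) μ
  have hV : ∀ μ, IsClosed (V μ : Set E) := fun μ => by
    have : (V μ : Set E) = {x | K x = μ • x} := by
      ext x; simp [V]
    rw [this]
    exact isClosed_eq K.continuous (continuous_const_smul μ)
  have hVc : ∀ μ, CompleteSpace (V μ) := fun μ => (hV μ).completeSpace_coe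
  choose s b hb using fun μ => exists_hilbertBasis ℝ (V μ)
  have hof := hs.orthogonalFamily_eigenspaces
  have ho : Orthonormal ℝ fun a : Σ μ : ℝ, s μ => ((b a.1 a.2 : V a.1) : E) :=
    hof.orthonormal_sigma_orthonormal (fun μ => (b μ).orthonormal)
  refine ⟨Σ μ : ℝ, s μ, HilbertBasis.mkOfOrthogonalEqBot ho ?_, fun a => a.1, fun a => ?_⟩
  · rw [eq_bot_iff, ← ContinuousLinearMap.orthogonalComplement_iSup_eigenspaces_eq_bot hc hs]
    intro x hx
    rw [Submodule.mem_orthogonal] at hx ⊢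
    intro u hu
    induction hu using Submodule.iSup_induction' with
    | mem μ y hy =>
      have h1 := (b μ).hasSum_repr (⟨y, hy⟩ : V μ)
      have h2 := (h1.mapL (V μ).subtypeL).mapL (innerSL ℝ x)
      have h3 : ∀ i, innerSL ℝ x ((V μ).subtypeL ((b μ).repr (⟨y, hy⟩ : V μ) i • b μ i)) = 0 := by
        intro i
        have := hx _ (Submodule.subset_span ⟨⟨μ, i⟩, rfl⟩)
        rw [real_inner_comm] at this
        rw [map_smul, map_smul]
        simp only [Submodule.subtypeL_apply, innerSL_apply_apply]
        rw [this, smul_zero]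
      simp only [h3] at h2
      rw [real_inner_comm]
      exact h2.unique hasSum_zero
    | zero => simp
    | add y z _ _ hy hz => rw [inner_add_left, hy, hz, add_zero]
  · rw [HilbertBasis.coe_mkOfOrthogonalEqBot]
    exact Module.End.mem_eigenspace_iff.1 (b a.1 a.2).2

/-- On L² the operator 𝒜⁻¹ is compact by Rellich and symmetric because (g, 𝒜⁻¹h) is the Dirichlet
form of 𝒜⁻¹g and 𝒜⁻¹h. Its eigenvalues μ are positive by injectivity; λ = 1/μ, and μ⁻¹𝒜⁻¹e is the
eigenfunction e seen in H¹₀. -/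
theorem exists_dirichletBasis (hd : 0 < d) (hΩ : IsOpen Ω) (hb : Bornology.IsBounded Ω) :
    Nonempty (DirichletBasis Ω) := by
  set K := (emb Ω).comp (invAL2 Ω) with hK
  have hin : ∀ g h, inner ℝ g (K h) = inner ℝ (grad Ω (invAL2 Ω g)) (grad Ω (invAL2 Ω h)) :=
    fun g h => (inner_grad_invAL2 hd hb g _).symm
  have hc : IsCompactOperator K := (isCompactOperator_emb hΩ.measurableSet hb).comp_clm _
  have hs : (K : L2 Ω →ₗ[ℝ] L2 Ω).IsSymmetric := by
    intro g h
    change inner ℝ (K g) h = inner ℝ g (K h)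
    rw [real_inner_comm, hin, hin, real_inner_comm]
  obtain ⟨ι, e, μ, he⟩ := exists_eigenvector_hilbertBasis hc hs
  have hμ : ∀ k, 0 < μ k := by
    intro k
    have h1 : inner ℝ (e k) (K (e k)) = μ k := by
      rw [he, inner_smul_right, real_inner_self_eq_norm_sq, e.orthonormal.1]; simp
    rw [← h1, hin, real_inner_self_eq_norm_sq]
    refine lt_of_le_of_ne (sq_nonneg _) fun h0 => ?_
    have h2 : grad Ω (invAL2 Ω (e k)) = 0 := by
      rw [← norm_eq_zero]; exact pow_eq_zero_iff two_ne_zero |>.1 h0.symm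
    have h3 : e k = 0 := eq_zero_of_forall_inner_emb hΩ fun v => by
      rw [← inner_grad_invAL2 hd hb, h2, inner_zero_left]
    have := e.orthonormal.1 k
    simp [h3] at this
  refine ⟨⟨ι, e, fun k => (μ k)⁻¹, fun k => (μ k)⁻¹ • invAL2 Ω (e k), fun k => inv_pos.2 (hμ k),
    fun k => ?_, fun k v => ?_⟩⟩
  · rw [map_smul]
    change (μ k)⁻¹ • K (e k) = e k
    rw [he, inv_smul_smul₀ (hμ k).ne']
  · rw [map_smul, inner_smul_left, inner_grad_invAL2 hd hb]
    simp

/-- Orthonormal vectors have distance √2, so balls of radius 1/2 about them are disjoint.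
Countability is needed to exchange sum and time integral in `hasSum_pairing`. -/
theorem _root_.Orthonormal.countable_of_separableSpace {E ι : Type*} [NormedAddCommGroup E]
    [InnerProductSpace ℝ E] [TopologicalSpace.SeparableSpace E] {e : ι → E}
    (he : Orthonormal ℝ e) : Countable ι := by
  refine Pairwise.countable_of_isOpen_disjoint (s := fun i => Metric.ball (e i) (1 / 2)) ?_
    (fun i => Metric.isOpen_ball) (fun i => ⟨e i, Metric.mem_ball_self (by norm_num)⟩)
  intro i j hij
  refine Metric.ball_disjoint_ball ?_
  rw [dist_eq_norm]
  have h1 : ‖e i - e j‖ ^ 2 = 2 := by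
    rw [@norm_sub_sq_real, he.1, he.1, he.2 hij]; norm_num
  nlinarith [norm_nonneg (e i - e j)]

theorem HilbertBasis.ext_inner {E ι : Type*} [NormedAddCommGroup E]
    [InnerProductSpace ℝ E] (e : HilbertBasis ι ℝ E) {x y : E}
    (h : ∀ k, inner ℝ (e k) x = inner ℝ (e k) y) : x = y := by
  refine e.repr.injective (lp.ext (funext fun k => ?_))
  rw [e.repr_apply_apply, e.repr_apply_apply, h]

theorem HilbertBasis.hasSum_norm_sq {E ι : Type*} [NormedAddCommGroup E]
    [InnerProductSpace ℝ E] (e : HilbertBasis ι ℝ E) (x : E) :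
    HasSum (fun k => inner ℝ (e k) x ^ 2) (‖x‖ ^ 2) := by
  have := e.hasSum_inner_mul_inner x x
  rw [real_inner_self_eq_norm_sq] at this
  refine this.congr_fun ?_ 
  intro k
  rw [real_inner_comm, sq]

/-! ### Eigenbasis coordinates and the operator 𝒜^{-1/2}. -/

namespace DirichletBasis

variable (b : DirichletBasis Ω)

instance : Countable b.ι := by
  have : Fact ((1 : ENNReal) ≤ 2) := ⟨by norm_num⟩
  have : Fact ((2 : ENNReal) ≠ ⊤) := ⟨by norm_num⟩
  exact b.e.orthonormal.countable_of_separableSpace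

/-- The normalized gradients of the eigenfunctions. -/
def f (k : b.ι) : L2Vec Ω := (√(b.lam k))⁻¹ • grad Ω (b.w k)

theorem sqrt_lam_pos (k : b.ι) : 0 < √(b.lam k) := Real.sqrt_pos.2 (b.lam_pos k)

theorem inner_f (k : b.ι) (v : H10 Ω) :
    inner ℝ (b.f k) (grad Ω v) = √(b.lam k) * inner ℝ (b.e k) (emb Ω v) := by
  have := (b.sqrt_lam_pos k).ne'
  rw [f, inner_smul_left, b.inner_w]
  simp only [conj_trivial]
  field_simp
  rw [Real.sq_sqrt (b.lam_pos k).le]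

theorem orthonormal_f : Orthonormal ℝ b.f := by
  classical
  rw [orthonormal_iff_ite]
  intro i j
  have h := (orthonormal_iff_ite.1 b.e.orthonormal) i j
  rw [f.eq_def b j, inner_smul_right, b.inner_f, b.emb_w, h]
  split_ifs with hij
  · subst hij
    have := (b.sqrt_lam_pos i).ne'
    field_simp
  · simp

/-- The isometry `ℓ² → L²(Ω; ℝᵈ)` with `b.f` as the image of the standard basis. -/
def iso : lp (fun _ : b.ι => ℝ) 2 →ₗᵢ[ℝ] L2Vec Ω :=
  b.orthonormal_f.orthogonalFamily.linearIsometry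

theorem inner_f_iso (k : b.ι) (x : lp (fun _ : b.ι => ℝ) 2) : inner ℝ (b.f k) (b.iso x) = x k := by
  classical
  have h : b.f k = b.iso (lp.single 2 k (1 : ℝ)) := by
    rw [iso, OrthogonalFamily.linearIsometry_apply_single]
    simp
  rw [h, LinearIsometry.inner_map_map, lp.inner_single_left]
  simp

/-- The `b.f k` need not be complete in L²(Ω; ℝᵈ), so the adjoint takes the place of an inverse: it
returns the coefficients of any field as an ℓ² sequence. -/
theorem adjoint_iso_apply (k : b.ι) (y : L2Vec Ω) :
    (ContinuousLinearMap.adjoint b.iso.toContinuousLinearMap y) k = inner ℝ (b.f k) y := by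
  classical
  have h : b.f k = b.iso (lp.single 2 k (1 : ℝ)) := by
    rw [iso, OrthogonalFamily.linearIsometry_apply_single]
    simp
  have h2 := ContinuousLinearMap.adjoint_inner_right b.iso.toContinuousLinearMap
    (lp.single 2 k (1 : ℝ)) y
  rw [lp.inner_single_left] at h2
  rw [h]
  simpa using h2

/-- The operator `𝒜^{-1/2}`, built from the eigenbasis. -/
def invSqrt : L2 Ω →L[ℝ] H10 Ω :=
  (invA Ω).comp ((innerSL ℝ).bilinearComp
    (b.iso.toContinuousLinearMap.comp b.e.repr.toContinuousLinearEquiv.toContinuousLinearMap)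
    (grad Ω))

/-- The field `b.iso (b.e.repr g)` is Σ g_k λ_k^{-1/2} ∇w_k, formally the gradient of 𝒜^{-1/2}g.
Solving the Dirichlet problem with it places the result in H¹₀; testing with w_k reads off a
coordinate. -/
theorem inner_emb_invSqrt (hd : 0 < d) (hb : Bornology.IsBounded Ω) (k : b.ι) (g : L2 Ω) :
    inner ℝ (b.e k) (emb Ω (b.invSqrt g)) = (√(b.lam k))⁻¹ * inner ℝ (b.e k) g := by
  have h1 : inner ℝ (grad Ω (b.invSqrt g)) (grad Ω (b.w k)) =
      inner ℝ (b.iso (b.e.repr g)) (grad Ω (b.w k)) := inner_grad_invA hd hb _ _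
  have h2 : grad Ω (b.w k) = √(b.lam k) • b.f k := by
    rw [f, smul_inv_smul₀ (b.sqrt_lam_pos k).ne']
  have h3 : inner ℝ (b.iso (b.e.repr g)) (grad Ω (b.w k)) =
      √(b.lam k) * inner ℝ (b.e k) g := by
    rw [h2, inner_smul_right, real_inner_comm, b.inner_f_iso, b.e.repr_apply_apply]
  rw [h3, real_inner_comm, b.inner_w] at h1
  have h4 := Real.sq_sqrt (b.lam_pos k).le
  have h5 := b.sqrt_lam_pos k
  rw [eq_inv_mul_iff_mul_eq₀ h5.ne']
  refine mul_left_cancel₀ h5.ne' ?_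
  rw [← h1, ← mul_assoc, ← sq, h4]

theorem inner_emb_invAL2 (hd : 0 < d) (hb : Bornology.IsBounded Ω) (k : b.ι) (g : L2 Ω) :
    inner ℝ (b.e k) (emb Ω (invAL2 Ω g)) = (b.lam k)⁻¹ * inner ℝ (b.e k) g := by
  have h1 := inner_grad_invAL2 hd hb g (b.w k)
  rw [real_inner_comm, b.inner_w, b.emb_w, show inner ℝ g (b.e k) = inner ℝ (b.e k) g from
    real_inner_comm _ _] at h1
  rw [← h1, inv_mul_cancel_left₀ (b.lam_pos k).ne']

theorem ext_emb (hΩ : IsOpen Ω) {v w : H10 Ω}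
    (h : ∀ k, inner ℝ (b.e k) (emb Ω v) = inner ℝ (b.e k) (emb Ω w)) : v = w :=
  emb_injective hΩ (HilbertBasis.ext_inner b.e h)

end DirichletBasis

namespace DirichletBasis
variable (b : DirichletBasis Ω)

theorem hasSum_inner (g h : L2 Ω) :
    HasSum (fun k => inner ℝ (b.e k) g * inner ℝ (b.e k) h) (inner ℝ g h) := by
  refine (b.e.hasSum_inner_mul_inner g h).congr_fun fun k => ?_
  rw [real_inner_comm]

theorem isInvSqrt_invSqrt (hd : 0 < d) (hb : Bornology.IsBounded Ω) :
    IsInvSqrt Ω b.invSqrt := by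
  have hin : ∀ g h, HasSum (fun k => (√(b.lam k))⁻¹ * (inner ℝ (b.e k) g * inner ℝ (b.e k) h))
      (inner ℝ (emb Ω (b.invSqrt g)) h) := by
    intro g h
    refine (b.hasSum_inner (emb Ω (b.invSqrt g)) h).congr_fun fun k => ?_
    rw [b.inner_emb_invSqrt hd hb, mul_assoc]
  refine ⟨⟨?_, fun g => ?_⟩, ?_⟩
  · intro g h
    refine (hin g h).unique ?_
    have := hin h g
    rw [real_inner_comm] at this
    refine this.congr_fun fun k => ?_
    rw [mul_comm (inner ℝ (b.e k) g)]
  · refine (hin g g).nonneg fun k => ?_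
    have := b.sqrt_lam_pos k
    have := mul_self_nonneg (inner ℝ (b.e k) g)
    positivity
  · ext1 g
    refine HilbertBasis.ext_inner b.e fun k => ?_
    simp only [ContinuousLinearMap.comp_apply]
    rw [b.inner_emb_invSqrt hd hb, b.inner_emb_invSqrt hd hb, b.inner_emb_invAL2 hd hb, ← mul_assoc,
      ← mul_inv, Real.mul_self_sqrt (b.lam_pos k).le]

/-- The positive square root of `𝒜⁻¹` is unique. -/
theorem eq_invSqrt_of_isInvSqrt (hd : 0 < d) (hΩ : IsOpen Ω) (hb : Bornology.IsBounded Ω)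
    {S : L2 Ω →L[ℝ] H10 Ω} (hS : IsInvSqrt Ω S) : S = b.invSqrt := by
  obtain ⟨hpos, hsq⟩ := hS
  set Q := (emb Ω).comp S with hQ
  have hsymm : ∀ g h, inner ℝ (Q g) h = inner ℝ g (Q h) := fun g h => hpos.1 g h
  have hsqa : ∀ g, Q (Q g) = emb Ω (invAL2 Ω g) := fun g => congrArg (fun T => T g) hsq
  have he : ∀ k, Q (b.e k) = (√(b.lam k))⁻¹ • b.e k := by
    intro k
    set s := (√(b.lam k))⁻¹ with hs
    have hspos : 0 < s := inv_pos.2 (b.sqrt_lam_pos k)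
    have hK : Q (Q (b.e k)) = (s * s) • b.e k := by
      rw [hsqa]
      refine HilbertBasis.ext_inner b.e fun j => ?_
      rw [b.inner_emb_invAL2 hd hb, inner_smul_right, hs, ← mul_inv,
        Real.mul_self_sqrt (b.lam_pos k).le]
      by_cases hjk : j = k
      · rw [hjk]
      · rw [b.e.orthonormal.2 hjk]; simp
    -- From Q²e = s²e follows (Q + s)y = 0; as Q ≥ 0 and s > 0, y vanishes.
    set y := Q (b.e k) - s • b.e k with hy
    have h1 : Q y = -(s • y) := by
      rw [hy, map_sub, hK, map_smul, smul_sub, smul_smul]; abel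
    have h2 : 0 ≤ inner ℝ (Q y) y := hpos.2 y
    rw [h1, inner_neg_left, inner_smul_left, real_inner_self_eq_norm_sq] at h2
    have h3 : ‖y‖ ^ 2 ≤ 0 := by
      simp only [conj_trivial] at h2
      by_contra h
      push Not at h
      nlinarith [mul_pos hspos h]
    have h4 : y = 0 := by
      rw [← norm_eq_zero]
      exact pow_eq_zero_iff two_ne_zero |>.1 (le_antisymm h3 (sq_nonneg _))
    exact sub_eq_zero.1 h4
  ext1 g
  refine b.ext_emb hΩ fun k => ?_
  rw [b.inner_emb_invSqrt hd hb]
  change inner ℝ (b.e k) (Q g) = _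
  rw [← hsymm, he, inner_smul_left]
  rfl

theorem invSqrtA_eq (hd : 0 < d) (hΩ : IsOpen Ω) (hb : Bornology.IsBounded Ω) :
    invSqrtA Ω = b.invSqrt := by
  have h : ∃ S, IsInvSqrt Ω S := ⟨_, b.isInvSqrt_invSqrt hd hb⟩
  rw [invSqrtA, dif_pos h]
  exact b.eq_invSqrt_of_isInvSqrt hd hΩ hb h.choose_spec

/-- The preimage has the coordinates √λ_k v_k. They are square summable because they are the
coefficients of ∇v in the orthonormal family `b.f`. -/
theorem exists_invSqrt_eq (hd : 0 < d) (hΩ : IsOpen Ω) (hb : Bornology.IsBounded Ω) (v : H10 Ω) :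
    ∃ g : L2 Ω, b.invSqrt g = v := by
  refine ⟨b.e.repr.symm (ContinuousLinearMap.adjoint b.iso.toContinuousLinearMap (grad Ω v)),
    b.ext_emb hΩ fun k => ?_⟩
  rw [b.inner_emb_invSqrt hd hb, ← b.e.repr_apply_apply, LinearIsometryEquiv.apply_symm_apply,
    b.adjoint_iso_apply, b.inner_f, inv_mul_cancel_left₀ (b.sqrt_lam_pos k).ne']

theorem inner_grad_invSqrt_left (hd : 0 < d) (hb : Bornology.IsBounded Ω) (g : L2 Ω) (v : H10 Ω) :
    HasSum (fun k => √(b.lam k) * (inner ℝ (b.e k) g * inner ℝ (b.e k) (emb Ω v)))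
      (inner ℝ (grad Ω (b.invSqrt g)) (grad Ω v)) := by
  have h1 : inner ℝ (grad Ω (b.invSqrt g)) (grad Ω v) = inner ℝ (b.iso (b.e.repr g)) (grad Ω v) :=
    inner_grad_invA hd hb _ _
  have h2 := ContinuousLinearMap.adjoint_inner_right b.iso.toContinuousLinearMap
    (b.e.repr g) (grad Ω v)
  rw [h1]
  refine (h2 ▸ lp.hasSum_inner (𝕜 := ℝ) _ _ :).congr_fun fun k => ?_
  rw [b.adjoint_iso_apply, b.inner_f, b.e.repr_apply_apply]
  simp only [RCLike.inner_apply, conj_trivial]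
  ring

/-- The isometry that makes the second components of 𝒞̃ and 𝒢 equal in norm: the factors √λ_k and
1/√λ_k cancel. -/
theorem inner_grad_invSqrt (hd : 0 < d) (hb : Bornology.IsBounded Ω) (g h : L2 Ω) :
    inner ℝ (grad Ω (b.invSqrt g)) (grad Ω (b.invSqrt h)) = inner ℝ g h := by
  refine (b.inner_grad_invSqrt_left hd hb g _).unique ?_
  refine (b.hasSum_inner g h).congr_fun fun k => ?_
  rw [b.inner_emb_invSqrt hd hb]
  have := (b.sqrt_lam_pos k).ne'
  field_simp

/-- Parseval for the Dirichlet form, obtained by writing u = 𝒜^{-1/2}g. -/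
theorem hasSum_inner_grad (hd : 0 < d) (hΩ : IsOpen Ω) (hb : Bornology.IsBounded Ω)
    (u v : H10 Ω) :
    HasSum (fun k => b.lam k * (inner ℝ (b.e k) (emb Ω u) * inner ℝ (b.e k) (emb Ω v)))
      (inner ℝ (grad Ω u) (grad Ω v)) := by
  obtain ⟨g, rfl⟩ := b.exists_invSqrt_eq hd hΩ hb u
  refine (b.inner_grad_invSqrt_left hd hb g v).congr_fun fun k => ?_
  rw [b.inner_emb_invSqrt hd hb]
  have h1 := (b.sqrt_lam_pos k).ne'
  have h2 := Real.sq_sqrt (b.lam_pos k).le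
  field_simp
  rw [h2]

theorem inner_grad_invSqrt_comm (hd : 0 < d) (hb : Bornology.IsBounded Ω)
    (u v : H10 Ω) : inner ℝ (grad Ω (b.invSqrt (emb Ω u))) (grad Ω v) =
      inner ℝ (grad Ω u) (grad Ω (b.invSqrt (emb Ω v))) := by
  rw [← real_inner_comm (grad Ω u)]
  refine (b.inner_grad_invSqrt_left hd hb _ v).unique
    ((b.inner_grad_invSqrt_left hd hb _ u).congr_fun fun k => ?_)
  ring

end DirichletBasis

/-! ### The heat flow in the eigenbasis -/

namespace DirichletBasis
variable (b : DirichletBasis Ω)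

theorem memℓp_mul {m : b.ι → ℝ} {M : ℝ} (hm : ∀ k, |m k| ≤ M) (g : L2 Ω) :
    Memℓp (fun k => m k * b.e.repr g k) 2 := by
  refine (memℓp_gen_iff (by norm_num)).2 ?_
  have h1 : Summable fun k => M ^ 2 * inner ℝ (b.e k) g ^ 2 :=
    (HilbertBasis.hasSum_norm_sq b.e g).summable.mul_left _
  refine h1.of_nonneg_of_le (fun k => by positivity) fun k => ?_
  rw [ENNReal.toReal_ofNat, Real.rpow_ofNat, Real.norm_eq_abs, sq_abs, mul_pow,
    b.e.repr_apply_apply, ← sq_abs (m k)]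
  have := hm k
  gcongr

open Classical in
/-- The operator with the eigenvalues `m` on the eigenbasis. -/
def mult (m : b.ι → ℝ) (g : L2 Ω) : L2 Ω :=
  b.e.repr.symm (if h : Memℓp (fun k => m k * b.e.repr g k) 2 then ⟨_, h⟩ else 0)

theorem inner_mult {m : b.ι → ℝ} {M : ℝ} (hm : ∀ k, |m k| ≤ M) (g : L2 Ω) (k : b.ι) :
    inner ℝ (b.e k) (b.mult m g) = m k * inner ℝ (b.e k) g := by
  rw [← b.e.repr_apply_apply, mult, dif_pos (b.memℓp_mul hm g),
    LinearIsometryEquiv.apply_symm_apply, ← b.e.repr_apply_apply]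

/-- Dominated convergence for Σ (c_k - c₀_k)² g_k², with majorant (2M)² g_k². It yields both the
continuity and the differentiability of the semigroup. -/
theorem tendsto_mult {α : Type*} {l : Filter α} {c : α → b.ι → ℝ} {c₀ : b.ι → ℝ} {M : ℝ}
    (hb : ∀ᶠ s in l, ∀ k, |c s k| ≤ M) (hb₀ : ∀ k, |c₀ k| ≤ M)
    (hc : ∀ k, Filter.Tendsto (fun s => c s k) l (nhds (c₀ k))) (g : L2 Ω) :
    Filter.Tendsto (fun s => b.mult (c s) g) l (nhds (b.mult c₀ g)) := by
  rw [tendsto_iff_norm_sub_tendsto_zero]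
  have h1 : Filter.Tendsto (fun s => ∑' k, ((c s k - c₀ k) * inner ℝ (b.e k) g) ^ 2) l
      (nhds (∑' k : b.ι, (0 : ℝ))) := by
    refine tendsto_tsum_of_dominated_convergence
      (bound := fun k => (2 * M) ^ 2 * inner ℝ (b.e k) g ^ 2)
      ((HilbertBasis.hasSum_norm_sq b.e g).summable.mul_left _) (fun k => ?_) ?_
    · have := (((hc k).sub_const (c₀ k)).mul_const (inner ℝ (b.e k) g)).pow 2
      simpa using this
    · filter_upwards [hb] with s hs k
      rw [Real.norm_eq_abs, abs_of_nonneg (sq_nonneg _), mul_pow, ← sq_abs (c s k - c₀ k)]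
      have : |c s k - c₀ k| ≤ 2 * M := (abs_sub _ _).trans (by linarith [hs k, hb₀ k])
      gcongr
  have h2 : (fun s => ∑' k, ((c s k - c₀ k) * inner ℝ (b.e k) g) ^ 2) =ᶠ[l]
      fun s => ‖b.mult (c s) g - b.mult c₀ g‖ ^ 2 := by
    filter_upwards [hb] with s hs
    rw [← (HilbertBasis.hasSum_norm_sq b.e _).tsum_eq]
    refine tsum_congr fun k => ?_
    rw [inner_sub_right, b.inner_mult hs, b.inner_mult hb₀, sub_mul]
  have h3 := (h1.congr' h2).sqrt
  simpa using h3

/-- The heat semigroup in the eigenbasis. -/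
def heat (t : ℝ) (g : L2 Ω) : L2 Ω := b.mult (fun k => Real.exp (-(b.lam k * t))) g

theorem abs_exp_le {t : ℝ} (ht : 0 ≤ t) (k : b.ι) : |Real.exp (-(b.lam k * t))| ≤ 1 := by
  rw [Real.abs_exp, Real.exp_le_one_iff, neg_nonpos]
  exact mul_nonneg (b.lam_pos k).le ht

theorem inner_heat {t : ℝ} (ht : 0 ≤ t) (g : L2 Ω) (k : b.ι) :
    inner ℝ (b.e k) (b.heat t g) = Real.exp (-(b.lam k * t)) * inner ℝ (b.e k) g :=
  b.inner_mult (b.abs_exp_le ht) g k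

theorem continuousOn_heat (g : L2 Ω) : ContinuousOn (fun t => b.heat t g) (Ici 0) := by
  intro t ht
  refine b.tendsto_mult (M := 1) ?_ (b.abs_exp_le ht) (fun k => ?_) g
  · filter_upwards [self_mem_nhdsWithin] with s hs
    exact b.abs_exp_le hs
  · have : Continuous fun s => Real.exp (-(b.lam k * s)) := by fun_prop
    exact this.continuousWithinAt

/-- The smoothing bound, from 1 + y ≤ e^y: for t > 0 the multiplier λe^{-λt} is bounded uniformly in
λ. -/
theorem mul_exp_neg_mul_le (x : ℝ) {t : ℝ} (ht : 0 < t) : x * Real.exp (-(x * t)) ≤ 1 / t := by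
  rw [Real.exp_neg, ← div_eq_mul_inv, div_le_div_iff₀ (Real.exp_pos _) ht, one_mul]
  linarith [Real.add_one_le_exp (x * t)]

/-- Difference quotients converge in each coordinate. On [t/2, ∞) the mean value inequality and the
smoothing bound keep them below 2/t for all k, so `tendsto_mult` applies. -/
theorem hasDerivAt_heat (g : L2 Ω) {t : ℝ} (ht : 0 < t) :
    HasDerivAt (fun s => b.heat s g)
      (b.mult (fun k => -(b.lam k * Real.exp (-(b.lam k * t)))) g) t := by
  have hd : ∀ k s, HasDerivAt (fun s => Real.exp (-(b.lam k * s)))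
      (-(b.lam k * Real.exp (-(b.lam k * s)))) s := fun k s => by
    have h1 : HasDerivAt (fun s => -(b.lam k * s)) (-b.lam k) s := by
      simpa using ((hasDerivAt_id s).const_mul (b.lam k)).fun_neg
    exact h1.exp.congr_deriv (by ring)
  have hbd : ∀ k s, t / 2 ≤ s → |-(b.lam k * Real.exp (-(b.lam k * s)))| ≤ 2 / t := by
    intro k s hs
    have hl := b.lam_pos k
    rw [abs_neg, abs_of_nonneg (by positivity)]
    calc b.lam k * Real.exp (-(b.lam k * s)) ≤ b.lam k * Real.exp (-(b.lam k * (t / 2))) := by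
          gcongr
      _ ≤ 1 / (t / 2) := mul_exp_neg_mul_le _ (by positivity)
      _ = 2 / t := by field_simp
  rw [hasDerivAt_iff_tendsto_slope]
  have hnear : ∀ᶠ s in nhdsWithin t {t}ᶜ, t / 2 ≤ s :=
    nhdsWithin_le_nhds (Ici_mem_nhds (by linarith))
  have hslope : ∀ s, t / 2 ≤ s →
      ∀ k, |slope (fun s => Real.exp (-(b.lam k * s))) t s| ≤ 2 / t := by
    intro s hs k
    have h1 := (convex_Ici (t / 2)).norm_image_sub_le_of_norm_hasDerivWithin_le
      (f := fun s => Real.exp (-(b.lam k * s))) (C := 2 / t)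
      (fun x _ => (hd k x).hasDerivWithinAt) (fun x hx => hbd k x hx)
      (show t ∈ Ici (t / 2) by simp only [mem_Ici]; linarith) (show s ∈ Ici (t / 2) from hs)
    rw [slope_def_field, abs_div]
    rcases eq_or_ne s t with rfl | hst
    · simp; positivity
    · rw [div_le_iff₀ (abs_pos.2 (sub_ne_zero.2 hst))]
      exact h1
  have h2 := b.tendsto_mult (l := nhdsWithin t {t}ᶜ) (M := 2 / t)
    (c := fun s k => slope (fun s => Real.exp (-(b.lam k * s))) t s)
    (hnear.mono hslope) (fun k => hbd k t (by linarith))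
    (fun k => hasDerivAt_iff_tendsto_slope.1 (hd k t)) g
  refine h2.congr' ?_
  filter_upwards [hnear] with s hs
  refine HilbertBasis.ext_inner b.e fun k => ?_
  rw [b.inner_mult (hslope s hs), slope_def_field, slope_def_module, inner_smul_right, inner_sub_right,
    b.inner_heat (by linarith), b.inner_heat ht.le]
  ring

theorem isHeatFlow_heat (hd : 0 < d) (hb : Bornology.IsBounded Ω) (g : L2 Ω) :
    IsHeatFlow Ω g fun t => b.heat t g := by
  refine ⟨b.continuousOn_heat g, ?_, fun t ht => ?_⟩
  · refine HilbertBasis.ext_inner b.e fun k => ?_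
    rw [b.inner_heat le_rfl]; simp
  have hm : ∀ k, |√(b.lam k) * Real.exp (-(b.lam k * t))| ≤ 1 + 1 / t := by
    intro k
    have hl := b.lam_pos k
    have h1 : √(b.lam k) ≤ 1 + b.lam k := by
      rw [Real.sqrt_le_left (by positivity)]; nlinarith
    have h2 := mul_exp_neg_mul_le (b.lam k) ht
    have h3 := (abs_le.1 (b.abs_exp_le ht.le k)).2
    rw [abs_of_nonneg (by positivity)]
    calc _ ≤ (1 + b.lam k) * Real.exp (-(b.lam k * t)) := by gcongr
      _ ≤ _ := by rw [add_mul, one_mul]; exact add_le_add h3 h2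
  have hm' : ∀ k, |-(b.lam k * Real.exp (-(b.lam k * t)))| ≤ 1 / t := by
    intro k
    have hl := b.lam_pos k
    rw [abs_neg, abs_of_nonneg (by positivity)]
    exact mul_exp_neg_mul_le _ ht
  -- The H¹₀ representative is 𝒜^{-1/2} applied to 𝒜^{1/2}e^{-𝒜t}g; the latter is in L² because √λ ≤
  -- 1 + λ.
  refine ⟨b.invSqrt (b.mult (fun k => √(b.lam k) * Real.exp (-(b.lam k * t))) g), _, ?_,
    b.hasDerivAt_heat g ht, ?_⟩
  · refine HilbertBasis.ext_inner b.e fun k => ?_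
    rw [b.inner_emb_invSqrt hd hb, b.inner_mult hm, b.inner_heat ht.le]
    have := (b.sqrt_lam_pos k).ne'
    field_simp
  · ext v
    rw [neg_apply, embDual_apply, opA_apply, ← inner_neg_left, ← map_neg, ← map_neg]
    refine (b.hasSum_inner _ _).unique ((b.inner_grad_invSqrt_left hd hb _ v).congr_fun fun k => ?_)
    rw [inner_neg_right, b.inner_mult hm, b.inner_mult hm']
    have := Real.sq_sqrt (b.lam_pos k).le
    linear_combination (Real.exp (-(b.lam k * t)) * inner ℝ (b.e k) g *
      inner ℝ (b.e k) (emb Ω v)) * this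

/-- The solution of the heat equation is unique. -/
theorem eq_heat_of_isHeatFlow {g : L2 Ω} {v : ℝ → L2 Ω} (hv : IsHeatFlow Ω g v) {t : ℝ}
    (ht : 0 ≤ t) : v t = b.heat t g := by
  obtain ⟨hc, h0, hv⟩ := hv
  refine HilbertBasis.ext_inner b.e fun k => ?_
  rw [b.inner_heat ht]
  rcases ht.eq_or_lt with rfl | ht
  · simp [h0]
  -- Integrating factor: the coordinate of v solves y' = -λy, so e^{λs} times it is constant.
  set y : ℝ → ℝ := fun s => Real.exp (b.lam k * s) * inner ℝ (b.e k) (v s) with hy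
  have hyc : ContinuousOn y (Icc 0 t) := by
    refine ContinuousOn.mul (by fun_prop) (ContinuousOn.inner continuousOn_const ?_)
    exact hc.mono Icc_subset_Ici_self
  have hyd : ∀ s ∈ Ioo 0 t, HasDerivAt y 0 s := by
    intro s hs
    obtain ⟨p, v', hp, hd, he⟩ := hv s hs.1
    have h1 : inner ℝ (b.e k) v' = -(b.lam k * inner ℝ (b.e k) (v s)) := by
      have h2 := congrArg (fun f => f (b.w k)) he
      simp only [embDual_apply, neg_apply, opA_apply] at h2
      rw [b.emb_w, real_inner_comm, real_inner_comm (grad Ω (b.w k)), b.inner_w, hp] at h2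
      exact h2
    have h3 := (((hasDerivAt_id s).const_mul (b.lam k)).exp).mul
      ((innerSL ℝ (b.e k)).hasFDerivAt.comp_hasDerivAt s hd)
    refine h3.congr_deriv ?_
    simp only [id, Function.comp, innerSL_apply_apply, h1]
    ring
  obtain ⟨c, -, hc'⟩ := exists_hasDerivAt_eq_slope y (fun _ => 0) ht hyc hyd
  have h4 : y t = y 0 := by
    have : y t - y 0 = 0 := by
      rw [eq_div_iff (by linarith : t - 0 ≠ 0)] at hc'
      linarith
    linarith
  simp only [hy, mul_zero, Real.exp_zero, one_mul, h0] at h4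
  rw [← h4, Real.exp_neg, inv_mul_cancel_left₀ (Real.exp_pos _).ne']

theorem heatSemigroup_eq (hd : 0 < d) (hb : Bornology.IsBounded Ω) (g : L2 Ω) {t : ℝ}
    (ht : 0 ≤ t) : heatSemigroup Ω t g = b.heat t g := by
  have h : ∃ v, IsHeatFlow Ω g v := ⟨_, b.isHeatFlow_heat hd hb g⟩
  rw [heatSemigroup, dif_pos h]
  exact b.eq_heat_of_isHeatFlow h.choose_spec ht

end DirichletBasis

/-- The heat flow with initial value in `H¹₀(Ω)` is continuous with values in `H¹₀(Ω)`. -/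
theorem exists_heat_orbit (hd : 0 < d) (hΩ : IsOpen Ω) (hb : Bornology.IsBounded Ω) (θ : H10 Ω) :
    ∃ w : ℝ → H10 Ω, ContinuousOn w (Ici 0) ∧ w 0 = θ ∧
      (∀ t, 0 ≤ t → heatSemigroup Ω t (emb Ω θ) = emb Ω (w t)) ∧
      ∀ t, 0 < t → ∃ v', HasDerivAt (fun s => emb Ω (w s)) v' t ∧ embDual Ω v' = -opA Ω (w t) := by
  obtain ⟨b⟩ := exists_dirichletBasis hd hΩ hb
  -- The semigroup commutes with 𝒜^{-1/2}, so continuity of e^{-𝒜t}g in L² becomes continuity of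
  -- e^{-𝒜t}θ in H¹₀.
  obtain ⟨g, rfl⟩ := b.exists_invSqrt_eq hd hΩ hb θ
  have hemb : ∀ t, 0 ≤ t → b.heat t (emb Ω (b.invSqrt g)) = emb Ω (b.invSqrt (b.heat t g)) := by
    intro t ht
    refine HilbertBasis.ext_inner b.e fun k => ?_
    rw [b.inner_heat ht, b.inner_emb_invSqrt hd hb, b.inner_emb_invSqrt hd hb, b.inner_heat ht]
    ring
  refine ⟨fun t => b.invSqrt (b.heat t g),
    b.invSqrt.continuous.comp_continuousOn (b.continuousOn_heat g), ?_, fun t ht => ?_,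
    fun t ht => ?_⟩
  · simp only [(b.isHeatFlow_heat hd hb g).2.1]
  · rw [b.heatSemigroup_eq hd hb _ ht, hemb t ht]
  · obtain ⟨p, v', hp, hv', he⟩ := (b.isHeatFlow_heat hd hb (emb Ω (b.invSqrt g))).2.2 t ht
    have : p = b.invSqrt (b.heat t g) := emb_injective hΩ (hp.trans (hemb t ht.le))
    refine ⟨v', hv'.congr_of_eventuallyEq ?_, by rw [he, this]⟩
    filter_upwards [Ioi_mem_nhds ht] with s hs
    exact (hemb s (le_of_lt hs)).symm

/-! ### Absolutely continuous functions of one variable -/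

theorem absolutelyContinuous_primitive {g : ℝ → ℝ} (hT : 0 ≤ T)
    (hg : IntegrableOn g (Ioo 0 T)) :
    AbsolutelyContinuousOnInterval (fun t => ∫ s in (0 : ℝ)..t, g s) 0 T ∧
    ∀ᵐ t, t ∈ Ioc 0 T → deriv (fun t => ∫ s in (0 : ℝ)..t, g s) t = g t := by
  have hi : IntervalIntegrable g volume 0 T :=
    (intervalIntegrable_iff_integrableOn_Ioo_of_le hT).2 hg
  refine ⟨hi.absolutelyContinuousOnInterval_intervalIntegral left_mem_uIcc, ?_⟩
  filter_upwards [hi.ae_hasDerivAt_integral] with t ht htm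
  exact (ht (by rw [uIcc_of_le hT]; exact Ioc_subset_Icc_self htm) 0 left_mem_uIcc).deriv

/-- Integration by parts for two primitives of integrable functions. -/
theorem integral_primitive_mul_add {g h : ℝ → ℝ} (hT : 0 ≤ T)
    (hg : IntegrableOn g (Ioo 0 T)) (hh : IntegrableOn h (Ioo 0 T)) :
    ∫ t in Ioo 0 T, (g t * (∫ s in (0 : ℝ)..t, h s) + (∫ s in (0 : ℝ)..t, g s) * h t) =
      (∫ s in (0 : ℝ)..T, g s) * ∫ s in (0 : ℝ)..T, h s := by
  obtain ⟨a1, d1⟩ := absolutelyContinuous_primitive hT hg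
  obtain ⟨a2, d2⟩ := absolutelyContinuous_primitive hT hh
  have := a1.integral_deriv_mul_eq_sub a2
  simp only [intervalIntegral.integral_same, mul_zero, sub_zero] at this
  rw [← this, ← integral_Ioc_eq_integral_Ioo, ← intervalIntegral.integral_of_le hT]
  refine intervalIntegral.integral_congr_ae ?_
  filter_upwards [d1, d2] with t h1 h2 ht
  rw [uIoc_of_le hT] at ht
  rw [h1 ht, h2 ht]

theorem integral_deriv_mul_primitive {g φ : ℝ → ℝ} (hT : 0 ≤ T)
    (hg : IntegrableOn g (Ioo 0 T)) (hφ : ContDiff ℝ ∞ φ) (hs : tsupport φ ⊆ Ioo 0 T) :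
    ∫ t in Ioo 0 T, deriv φ t * (∫ s in (0 : ℝ)..t, g s) = -∫ t in Ioo 0 T, φ t * g t := by
  obtain ⟨a1, d1⟩ := absolutelyContinuous_primitive hT hg
  have a2 : AbsolutelyContinuousOnInterval φ 0 T :=
    (hφ.of_le (by simp)).contDiffOn.absolutelyContinuousOnInterval
  have := a2.integral_mul_deriv_eq_deriv_mul a1
  have h0 : φ T = 0 := image_eq_zero_of_notMem_tsupport fun h => lt_irrefl _ (hs h).2
  rw [intervalIntegral.integral_same, mul_zero, h0, zero_mul, sub_self, zero_sub] at this
  rw [← integral_Ioc_eq_integral_Ioo, ← integral_Ioc_eq_integral_Ioo,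
    ← intervalIntegral.integral_of_le hT, ← intervalIntegral.integral_of_le hT, eq_neg_iff_add_eq_zero,
    ← neg_eq_iff_add_eq_zero, ← this]
  refine intervalIntegral.integral_congr_ae ?_
  filter_upwards [d1] with t h1 ht
  rw [uIoc_of_le hT] at ht
  rw [h1 ht]

/-- A smooth function of mean zero with compact support in an interval has a primitive with
compact support there. -/
theorem exists_primitive_of_integral_eq_zero {η : ℝ → ℝ} (h1 : ContDiff ℝ ∞ η)
    (h2 : HasCompactSupport η) (h3 : tsupport η ⊆ Ioo 0 T) (h4 : ∫ t, η t = 0) :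
    ∃ φ : ℝ → ℝ, ContDiff ℝ ∞ φ ∧ HasCompactSupport φ ∧ tsupport φ ⊆ Ioo 0 T ∧ deriv φ = η := by
  rcases (tsupport η).eq_empty_or_nonempty with he | hne
  · have : η = 0 := tsupport_eq_empty_iff.1 he
    refine ⟨0, contDiff_const, HasCompactSupport.zero, by simp [tsupport], ?_⟩
    rw [this]; ext; simp
  -- The primitive starts at the least point of the support and, by the zero mean, vanishes again
  -- beyond the greatest.
  obtain ⟨a, ha, hal⟩ := h2.isCompact.exists_isLeast hne
  obtain ⟨c, hc, hcl⟩ := h2.isCompact.exists_isGreatest hne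
  have hη0 : ∀ t, t ∉ Icc a c → η t = 0 := fun t ht =>
    image_eq_zero_of_notMem_tsupport fun h => ht ⟨hal h, hcl h⟩
  have hcont := h1.continuous
  have hint : Integrable η := hcont.integrable_of_hasCompactSupport h2
  have hder : ∀ t, HasDerivAt (fun t => ∫ s in a..t, η s) (η t) t := fun t =>
    intervalIntegral.integral_hasDerivAt_right (hcont.intervalIntegrable _ _)
      (hcont.stronglyMeasurableAtFilter _ _) hcont.continuousAt
  have hsupp : tsupport (fun t => ∫ s in a..t, η s) ⊆ Icc a c := by
    refine closure_minimal (fun t ht => ?_) isClosed_Icc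
    by_contra htn
    refine ht ?_
    simp only [mem_Icc, not_and_or, not_le] at htn
    rcases htn with h | h
    · simp only
      rw [intervalIntegral.integral_symm, neg_eq_zero]
      refine intervalIntegral.integral_zero_ae ?_
      have : ∀ᵐ s : ℝ, s ≠ a := by simp [ae_iff, measure_singleton]
      filter_upwards [this] with s hsa hs
      rw [uIoc_of_le h.le] at hs
      exact hη0 s fun h' => hsa (le_antisymm hs.2 h'.1)
    · simp only
      rw [intervalIntegral.integral_of_le ((hcl ha).trans h.le), ← integral_Icc_eq_integral_Ioc,
        setIntegral_eq_integral_of_forall_compl_eq_zero, h4]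
      intro s hs
      exact hη0 s fun h' => hs ⟨h'.1, h'.2.trans h.le⟩
  have hdeq : deriv (fun t => ∫ s in a..t, η s) = η := funext fun t => (hder t).deriv
  refine ⟨fun t => ∫ s in a..t, η s, ?_, ?_, ?_, hdeq⟩
  · rw [contDiff_infty_iff_deriv, hdeq]
    exact ⟨fun t => (hder t).differentiableAt, h1⟩
  · exact isCompact_Icc.of_isClosed_subset (isClosed_tsupport _) hsupp
  · exact hsupp.trans (Icc_subset_Ioo (h3 ha).1 (h3 hc).2)

/-- The lemma of du Bois-Reymond. -/
theorem eq_of_forall_integral_deriv_mul_eq_zero (hT : 0 < T) {y : ℝ → ℝ}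
    (hy : ContinuousOn y (Icc 0 T))
    (h : ∀ φ : ℝ → ℝ, ContDiff ℝ ∞ φ → HasCompactSupport φ → tsupport φ ⊆ Ioo 0 T →
      ∫ t in Ioo 0 T, deriv φ t * y t = 0) {t : ℝ} (ht : t ∈ Icc 0 T) : y t = y 0 := by
  let f : ContDiffBump (T / 2) := ⟨T / 8, T / 4, by positivity, by linarith⟩
  set ψ₀ := f.normed volume with hψ₀
  have p1 : ContDiff ℝ ∞ ψ₀ := f.contDiff_normed
  have p2 : HasCompactSupport ψ₀ := f.hasCompactSupport_normed
  have p3 : tsupport ψ₀ ⊆ Ioo 0 T := by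
    rw [hψ₀, f.tsupport_normed_eq, Real.closedBall_eq_Icc]
    exact Icc_subset_Ioo (by simp only [f]; linarith) (by simp only [f]; linarith)
  have p4 : ∫ t, ψ₀ t = 1 := f.integral_normed
  have hyi : IntegrableOn y (Ioo 0 T) :=
    (hy.integrableOn_compact isCompact_Icc).mono_set Ioo_subset_Icc_self
  have hmul : ∀ ψ : ℝ → ℝ, ContDiff ℝ ∞ ψ → IntegrableOn (fun t => ψ t * y t) (Ioo 0 T) := by
    intro ψ h1
    exact ((h1.continuous.continuousOn.mul hy).integrableOn_compact isCompact_Icc).mono_set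
      Ioo_subset_Icc_self
  set c := ∫ t in Ioo 0 T, ψ₀ t * y t with hc
  have key : ∀ᵐ t, t ∈ Ioo 0 T → y t - c = 0 := by
    refine isOpen_Ioo.ae_eq_zero_of_integral_contDiff_smul_eq_zero
      (hyi.sub (integrableOn_const (by simp))).locallyIntegrableOn fun ψ h1 h2 h3 => ?_
    have hψi : Integrable ψ := h1.continuous.integrable_of_hasCompactSupport h2
    have hψ₀i : Integrable ψ₀ := p1.continuous.integrable_of_hasCompactSupport p2
    set m := ∫ t, ψ t with hm
    -- Subtracting m times the bump ψ₀ of mass one makes the mean zero, so the difference is the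
    -- derivative of a test function. This identifies y with the constant c = ∫ψ₀y.
    obtain ⟨φ, q1, q2, q3, q4⟩ := exists_primitive_of_integral_eq_zero (T := T)
      (η := fun t => ψ t - m * ψ₀ t) (h1.sub (contDiff_const.mul p1))
      (h2.sub (HasCompactSupport.mul_left p2))
      ((tsupport_sub _ _).trans (union_subset h3 ((tsupport_mul_subset_right).trans p3)))
      (by rw [integral_sub hψi (hψ₀i.const_mul _), integral_const_mul, p4, ← hm]; ring)
    have h5 := h φ q1 q2 q3
    rw [q4] at h5
    simp only [sub_mul, mul_assoc] at h5
    rw [integral_sub (hmul ψ h1) ((hmul ψ₀ p1).const_mul _), integral_const_mul, ← hc] at h5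
    rw [← setIntegral_eq_integral_of_forall_compl_eq_zero (s := Ioo 0 T)]
    · simp only [smul_eq_mul, mul_sub]
      rw [integral_sub (hmul ψ h1) (hψi.integrableOn.mul_const _), integral_mul_const,
        setIntegral_eq_integral_of_forall_compl_eq_zero (s := Ioo 0 T) (f := ψ), ← hm]
      · linarith
      · intro x hx
        exact image_eq_zero_of_notMem_tsupport fun h => hx (h3 h)
    · intro x hx
      rw [image_eq_zero_of_notMem_tsupport fun h => hx (h3 h), zero_smul]
  have heq : EqOn y (fun _ => c) (Icc 0 T) := by
    have h1 : EqOn y (fun _ => c) (Ioo 0 T) := by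
      refine Measure.eqOn_open_of_ae_eq (μ := volume) ?_ isOpen_Ioo
        (hy.mono Ioo_subset_Icc_self) continuousOn_const
      rw [Filter.EventuallyEq, ae_restrict_iff' measurableSet_Ioo]
      filter_upwards [key] with t h ht
      linarith [h ht]
    exact h1.of_subset_closure hy continuousOn_const Ioo_subset_Icc_self
      (by rw [closure_Ioo hT.ne])
  rw [heq ht, heq (left_mem_Icc.2 hT.le)]

/-- A continuous function with an integrable weak derivative is a primitive of it. -/
theorem eq_primitive_of_weakDeriv (hT : 0 < T) {z g : ℝ → ℝ} (hz : ContinuousOn z (Icc 0 T))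
    (hg : IntegrableOn g (Ioo 0 T))
    (h : ∀ φ : ℝ → ℝ, ContDiff ℝ ∞ φ → HasCompactSupport φ → tsupport φ ⊆ Ioo 0 T →
      ∫ t in Ioo 0 T, deriv φ t * z t = -∫ t in Ioo 0 T, φ t * g t) {t : ℝ}
    (ht : t ∈ Icc 0 T) : z t = z 0 + ∫ s in (0 : ℝ)..t, g s := by
  have hG : ContinuousOn (fun t => ∫ s in (0 : ℝ)..t, g s) (Icc 0 T) := by
    have := (absolutelyContinuous_primitive hT.le hg).1.continuousOn
    rwa [uIcc_of_le hT.le] at this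
  have := eq_of_forall_integral_deriv_mul_eq_zero hT (hz.sub hG) (fun φ h1 h2 h3 => ?_) ht
  · simp only [Pi.sub_apply, intervalIntegral.integral_same, sub_zero] at this
    linarith
  · have hc : Continuous (deriv φ) := h1.continuous_deriv (by simp)
    have hi : ∀ y, ContinuousOn y (Icc 0 T) →
        IntegrableOn (fun t => deriv φ t * y t) (Ioo 0 T) := fun y hy =>
      ((hc.continuousOn.mul hy).integrableOn_compact isCompact_Icc).mono_set Ioo_subset_Icc_self
    simp only [Pi.sub_apply, mul_sub]
    rw [integral_sub (hi _ hz) (hi _ hG), h φ h1 h2 h3, integral_deriv_mul_primitive hT.le hg h1 h3,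
      sub_self]

/-! ### Weak time derivatives and the energy identity -/

theorem integrable_smul_Lp {E : Type*} [NormedAddCommGroup E] [NormedSpace ℝ E] {φ : ℝ → ℝ}
    (hφ : Continuous φ) (hc : HasCompactSupport φ)
    (f : Lp E 2 (volume.restrict (Ioo (0 : ℝ) T))) :
    Integrable (fun t => φ t • f t) (volume.restrict (Ioo (0 : ℝ) T)) := by
  have h : MemLp φ 2 (volume.restrict (Ioo (0 : ℝ) T)) :=
    (hφ.memLp_of_hasCompactSupport hc).restrict _
  exact memLp_one_iff_integrable.1 ((Lp.memLp f).smul h)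

theorem integrable_Lp {E : Type*} [NormedAddCommGroup E]
    (f : Lp E 2 (volume.restrict (Ioo (0 : ℝ) T))) :
    Integrable f (volume.restrict (Ioo (0 : ℝ) T)) :=
  (Lp.memLp f).integrable (by norm_num)

section Abstract

variable {V H E : Type*} [NormedAddCommGroup V] [NormedSpace ℝ V] [NormedAddCommGroup H]
  [InnerProductSpace ℝ H] [NormedAddCommGroup E] [NormedSpace ℝ E]

theorem Lp.eq_of_forall_integral_smul_eq [CompleteSpace E]
    {g g' : Lp E 2 (volume.restrict (Ioo (0 : ℝ) T))}
    (h : ∀ φ : ℝ → ℝ, ContDiff ℝ ∞ φ → HasCompactSupport φ → tsupport φ ⊆ Ioo 0 T →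
      ∫ t in Ioo (0 : ℝ) T, φ t • g t = ∫ t in Ioo (0 : ℝ) T, φ t • g' t) : g = g' := by
  have key : ∀ᵐ t, t ∈ Ioo 0 T → (g t - g' t : E) = 0 := by
    refine isOpen_Ioo.ae_eq_zero_of_integral_contDiff_smul_eq_zero
      (IntegrableOn.locallyIntegrableOn ((integrable_Lp g).sub (integrable_Lp g')))
      fun φ h1 h2 h3 => ?_
    rw [← setIntegral_eq_integral_of_forall_compl_eq_zero (s := Ioo 0 T)]
    · simp only [smul_sub]
      rw [integral_sub (integrable_smul_Lp h1.continuous h2 g)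
        (integrable_smul_Lp h1.continuous h2 g'), sub_eq_zero, h φ h1 h2 h3]
    · intro x hx
      rw [image_eq_zero_of_notMem_tsupport fun h => hx (h3 h), zero_smul]
  refine Lp.ext ?_
  rw [Filter.EventuallyEq, ae_restrict_iff' measurableSet_Ioo]
  filter_upwards [key] with t ht htm
  exact sub_eq_zero.1 (ht htm)

/-- A continuous linear map, applied pointwise in time. -/
def applyT (T : ℝ) (L : V →L[ℝ] E) :
    Lp V 2 (volume.restrict (Ioo (0 : ℝ) T)) →L[ℝ] Lp E 2 (volume.restrict (Ioo (0 : ℝ) T)) :=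
  L.compLpL 2 (volume.restrict (Ioo (0 : ℝ) T))

theorem coeFn_applyT (L : V →L[ℝ] E) (f : Lp V 2 (volume.restrict (Ioo (0 : ℝ) T))) :
    ∀ᵐ t ∂(volume.restrict (Ioo (0 : ℝ) T)), applyT T L f t = L (f t) :=
  L.coeFn_compLpL f

theorem integrable_dual_apply (g : Lp (V →L[ℝ] ℝ) 2 (volume.restrict (Ioo (0 : ℝ) T))) (p : V) :
    IntegrableOn (fun t => g t p) (Ioo (0 : ℝ) T) :=
  (ContinuousLinearMap.apply ℝ ℝ p).integrable_comp (integrable_Lp g)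

theorem integrable_mul_dual_apply {φ : ℝ → ℝ} (hφ : Continuous φ) (hc : HasCompactSupport φ)
    (g : Lp (V →L[ℝ] ℝ) 2 (volume.restrict (Ioo (0 : ℝ) T))) (p : V) :
    Integrable (fun t => φ t * g t p) (volume.restrict (Ioo (0 : ℝ) T)) :=
  (ContinuousLinearMap.apply ℝ ℝ p).integrable_comp (integrable_smul_Lp hφ hc g)

theorem integral_smul_dual_apply {φ : ℝ → ℝ} (hφ : Continuous φ) (hc : HasCompactSupport φ)
    (g : Lp (V →L[ℝ] ℝ) 2 (volume.restrict (Ioo (0 : ℝ) T))) (p : V) :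
    (∫ t in Ioo (0 : ℝ) T, φ t • g t) p = ∫ t in Ioo (0 : ℝ) T, φ t * g t p := by
  rw [ContinuousLinearMap.integral_apply (integrable_smul_Lp hφ hc g)]
  rfl

theorem integral_smul_inner_apply (j : V →L[ℝ] H) {φ : ℝ → ℝ} (hφ : Continuous φ)
    (hc : HasCompactSupport φ) (f : Lp V 2 (volume.restrict (Ioo (0 : ℝ) T))) (p : V) :
    (∫ t in Ioo (0 : ℝ) T,
      φ t • ((innerSL ℝ).bilinearComp (ContinuousLinearMap.id ℝ H) j (j (f t)))) p =
      ∫ t in Ioo (0 : ℝ) T, φ t * inner ℝ (j (f t)) (j p) := by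
  rw [ContinuousLinearMap.integral_apply]
  · rfl
  · refine ((((innerSL ℝ).bilinearComp (ContinuousLinearMap.id ℝ H) j).comp j).integrable_comp
      (integrable_smul_Lp hφ hc f)).congr (.of_forall fun t => ?_)
    simp

end Abstract

theorem integrable_apply (g : L2Hm1 T Ω) (p : H10 Ω) :
    IntegrableOn (fun t => g t p) (Ioo (0 : ℝ) T) := integrable_dual_apply (V := H10 Ω) g p

/-- The weak time derivative, tested with a fixed element of `H¹₀(Ω)`. -/
theorem hasWeakTimeDeriv_iff {u : L2H10 T Ω} {g : L2Hm1 T Ω} :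
    HasWeakTimeDeriv T Ω u g ↔ ∀ φ : ℝ → ℝ, ContDiff ℝ ∞ φ → HasCompactSupport φ →
      tsupport φ ⊆ Ioo 0 T → ∀ p : H10 Ω,
      ∫ t in Ioo (0 : ℝ) T, deriv φ t * inner ℝ (emb Ω (u t)) (emb Ω p) =
        -∫ t in Ioo (0 : ℝ) T, φ t * g t p := by
  refine forall_congr' fun φ => forall_congr' fun h1 => forall_congr' fun h2 =>
    forall_congr' fun _ => ?_
  have e1 := integral_smul_inner_apply (V := H10 Ω) (H := L2 Ω) (emb Ω)
    (h1.continuous_deriv (by simp)) h2.deriv u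
  have e2 := integral_smul_dual_apply (V := H10 Ω) h1.continuous h2 g
  constructor
  · intro h p
    rw [← e1, ← e2]
    exact congrArg (fun f => f p) h
  · intro h
    refine ContinuousLinearMap.ext fun p => ?_
    have := h p
    rw [← e1, ← e2] at this
    exact this

theorem HasWeakTimeDeriv.unique {u : L2H10 T Ω} {g g' : L2Hm1 T Ω}
    (h : HasWeakTimeDeriv T Ω u g) (h' : HasWeakTimeDeriv T Ω u g') : g = g' := by
  refine Lp.eq_of_forall_integral_smul_eq (E := Hm1 Ω) fun φ h1 h2 h3 => ?_
  rw [← neg_inj, ← h φ h1 h2 h3, ← h' φ h1 h2 h3]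

theorem timeDeriv_eq {u : L2H10 T Ω} {g : L2Hm1 T Ω} (h : HasWeakTimeDeriv T Ω u g) :
    timeDeriv T Ω u = g := by
  have hex : ∃ g, HasWeakTimeDeriv T Ω u g := ⟨g, h⟩
  rw [timeDeriv, dif_pos hex]
  exact hex.choose_spec.unique h

/-- Continuous functions that agree almost everywhere agree on (0,T) and, by closure, at the
endpoints; so u(0) and u(T) do not depend on the representative. -/
theorem IsContRep.eqOn (hT : 0 < T) {u : L2H10 T Ω} {v v' : ℝ → L2 Ω} (h : IsContRep T Ω u v)
    (h' : IsContRep T Ω u v') : EqOn v v' (Icc 0 T) := by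
  have h1 : EqOn v v' (Ioo 0 T) := by
    refine Measure.eqOn_open_of_ae_eq (μ := volume) ?_ isOpen_Ioo
      (h.1.mono Ioo_subset_Icc_self) (h'.1.mono Ioo_subset_Icc_self)
    filter_upwards [h.2, h'.2] with t h1 h2
    rw [← h1, h2]
  exact h1.of_subset_closure h.1 h'.1 Ioo_subset_Icc_self (by rw [closure_Ioo hT.ne])

theorem deltaT_eq (hT : 0 < T) {u : L2H10 T Ω} {v : ℝ → L2 Ω} (h : IsContRep T Ω u v) :
    deltaT T Ω u = v T := by
  have hex : ∃ v, IsContRep T Ω u v := ⟨v, h⟩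
  rw [deltaT, dif_pos hex]
  exact hex.choose_spec.eqOn hT h (right_mem_Icc.2 hT.le)

theorem integrable_mul_inner_emb {φ : ℝ → ℝ} (h1 : ContDiff ℝ ∞ φ) (h2 : HasCompactSupport φ)
    (u : L2H10 T Ω) (p : H10 Ω) :
    Integrable (fun t => deriv φ t * inner ℝ (emb Ω (u t)) (emb Ω p))
      (volume.restrict (Ioo (0 : ℝ) T)) := by
  refine ((((innerSL ℝ) (emb Ω p)).comp (emb Ω)).integrable_comp
    (integrable_smul_Lp (h1.continuous_deriv (by simp)) h2.deriv u)).congr (.of_forall fun t => ?_)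
  simp [real_inner_comm]

theorem integrable_mul_apply {φ : ℝ → ℝ} (h1 : ContDiff ℝ ∞ φ) (h2 : HasCompactSupport φ)
    (g : L2Hm1 T Ω) (p : H10 Ω) :
    Integrable (fun t => φ t * g t p) (volume.restrict (Ioo (0 : ℝ) T)) :=
  integrable_mul_dual_apply (V := H10 Ω) h1.continuous h2 g p

theorem HasWeakTimeDeriv.add {u u' : L2H10 T Ω} {g g' : L2Hm1 T Ω}
    (h : HasWeakTimeDeriv T Ω u g) (h' : HasWeakTimeDeriv T Ω u' g') :
    HasWeakTimeDeriv T Ω (u + u') (g + g') := by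
  rw [hasWeakTimeDeriv_iff] at *
  intro φ h1 h2 h3 p
  have e1 : ∫ t in Ioo (0 : ℝ) T, deriv φ t * inner ℝ (emb Ω ((u + u') t)) (emb Ω p) =
      ∫ t in Ioo (0 : ℝ) T, (deriv φ t * inner ℝ (emb Ω (u t)) (emb Ω p) +
        deriv φ t * inner ℝ (emb Ω (u' t)) (emb Ω p)) := by
    refine integral_congr_ae ?_
    filter_upwards [Lp.coeFn_add u u'] with t ht
    rw [ht, Pi.add_apply, map_add, inner_add_left, mul_add]
  have e2 : ∫ t in Ioo (0 : ℝ) T, φ t * (g + g') t p =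
      ∫ t in Ioo (0 : ℝ) T, (φ t * g t p + φ t * g' t p) := by
    refine integral_congr_ae ?_
    filter_upwards [Lp.coeFn_add g g'] with t ht
    rw [ht, ← mul_add]
    rfl
  rw [e1, e2, integral_add (integrable_mul_inner_emb h1 h2 u p)
    (integrable_mul_inner_emb h1 h2 u' p), integral_add (integrable_mul_apply h1 h2 g p)
    (integrable_mul_apply h1 h2 g' p), h φ h1 h2 h3, h' φ h1 h2 h3, neg_add]

theorem IsContRep.add {u u' : L2H10 T Ω} {v v' : ℝ → L2 Ω} (h : IsContRep T Ω u v)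
    (h' : IsContRep T Ω u' v') : IsContRep T Ω (u + u') (v + v') := by
  refine ⟨h.1.add h'.1, ?_⟩
  filter_upwards [h.2, h'.2, Lp.coeFn_add u u'] with t h1 h2 h3
  rw [h3, Pi.add_apply, Pi.add_apply, map_add, h1, h2]

theorem U0.hasWeakTimeDeriv {u : L2H10 T Ω} (hu : u ∈ U0 T Ω) :
    HasWeakTimeDeriv T Ω u (timeDeriv T Ω u) := by
  obtain ⟨⟨g, hg⟩, -⟩ := hu
  rwa [timeDeriv_eq hg]

theorem U0.exists_contRep (hT : 0 < T) {u : L2H10 T Ω} (hu : u ∈ U0 T Ω) :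
    ∃ v, IsContRep T Ω u v ∧ v 0 = 0 ∧ v T = deltaT T Ω u := by
  obtain ⟨-, v, hv, h0⟩ := hu
  exact ⟨v, hv, h0, (deltaT_eq hT hv).symm⟩

theorem U0.add {u u' : L2H10 T Ω} (hu : u ∈ U0 T Ω) (hu' : u' ∈ U0 T Ω) : u + u' ∈ U0 T Ω := by
  obtain ⟨⟨g, hg⟩, v, hv, h0⟩ := hu
  obtain ⟨⟨g', hg'⟩, v', hv', h0'⟩ := hu'
  exact ⟨⟨_, hg.add hg'⟩, _, hv.add hv', by simp [h0, h0']⟩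

/-- Because of the default value 0, additivity is claimed only on U₀, where the weak derivative
exists. -/
theorem timeDeriv_add {u u' : L2H10 T Ω} (hu : u ∈ U0 T Ω) (hu' : u' ∈ U0 T Ω) :
    timeDeriv T Ω (u + u') = timeDeriv T Ω u + timeDeriv T Ω u' :=
  timeDeriv_eq ((U0.hasWeakTimeDeriv hu).add (U0.hasWeakTimeDeriv hu'))

theorem deltaT_add (hT : 0 < T) {u u' : L2H10 T Ω} (hu : u ∈ U0 T Ω) (hu' : u' ∈ U0 T Ω) :
    deltaT T Ω (u + u') = deltaT T Ω u + deltaT T Ω u' := by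
  obtain ⟨v, hv, -, h1⟩ := U0.exists_contRep hT hu
  obtain ⟨v', hv', -, h1'⟩ := U0.exists_contRep hT hu'
  rw [deltaT_eq hT (hv.add hv'), ← h1, ← h1', Pi.add_apply]

theorem hasWeakTimeDeriv_zero : HasWeakTimeDeriv T Ω 0 0 := by
  rw [hasWeakTimeDeriv_iff]
  intro φ _ _ _ p
  have e1 : ∫ t in Ioo (0 : ℝ) T, deriv φ t * inner ℝ (emb Ω ((0 : L2H10 T Ω) t)) (emb Ω p) =
      0 := by
    refine integral_eq_zero_of_ae ?_
    filter_upwards [Lp.coeFn_zero (H10 Ω) 2 (volume.restrict (Ioo (0 : ℝ) T))] with t ht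
    rw [ht, Pi.zero_apply, map_zero, inner_zero_left, mul_zero, Pi.zero_apply]
  have e2 : ∫ t in Ioo (0 : ℝ) T, φ t * (0 : L2Hm1 T Ω) t p = 0 := by
    refine integral_eq_zero_of_ae ?_
    filter_upwards [Lp.coeFn_zero (Hm1 Ω) 2 (volume.restrict (Ioo (0 : ℝ) T))] with t ht
    rw [ht]
    exact mul_zero _
  rw [e1, e2, neg_zero]

theorem isContRep_zero : IsContRep T Ω 0 0 := by
  refine ⟨continuousOn_const, ?_⟩
  filter_upwards [Lp.coeFn_zero (H10 Ω) 2 (volume.restrict (Ioo (0 : ℝ) T))] with t ht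
  rw [ht, Pi.zero_apply, map_zero, Pi.zero_apply]

theorem zero_mem_U0 : (0 : L2H10 T Ω) ∈ U0 T Ω :=
  ⟨⟨0, hasWeakTimeDeriv_zero⟩, 0, isContRep_zero, rfl⟩

/-- The gradient, pointwise in time. -/
def gradT (T : ℝ) (Ω : Set (EuclideanSpace ℝ (Fin d))) :
    L2H10 T Ω →L[ℝ] Lp (L2Vec Ω) 2 (volume.restrict (Ioo (0 : ℝ) T)) :=
  applyT (V := H10 Ω) (E := L2Vec Ω) T (grad Ω)

/-- The operator `∇𝒜⁻¹`, pointwise in time. -/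
def gradInvT (T : ℝ) (Ω : Set (EuclideanSpace ℝ (Fin d))) :
    L2Hm1 T Ω →L[ℝ] Lp (L2Vec Ω) 2 (volume.restrict (Ioo (0 : ℝ) T)) :=
  applyT (V := Hm1 Ω) (E := L2Vec Ω) T ((grad Ω).comp (invA Ω))

theorem coeFn_gradT (u : L2H10 T Ω) :
    ∀ᵐ t ∂(volume.restrict (Ioo (0 : ℝ) T)), gradT T Ω u t = grad Ω (u t) := by
  have h := coeFn_applyT (T := T) (V := H10 Ω) (E := L2Vec Ω) (grad Ω) u
  exact h

theorem coeFn_gradInvT (f : L2Hm1 T Ω) :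
    ∀ᵐ t ∂(volume.restrict (Ioo (0 : ℝ) T)), gradInvT T Ω f t = grad Ω (invA Ω (f t)) := by
  have h := coeFn_applyT (T := T) (V := Hm1 Ω) (E := L2Vec Ω) ((grad Ω).comp (invA Ω)) f
  exact h

theorem integrable_norm_grad_sq (u : L2H10 T Ω) :
    Integrable (fun t => ‖grad Ω (u t)‖ ^ 2) (volume.restrict (Ioo (0 : ℝ) T)) := by
  refine (L2.integrable_inner (𝕜 := ℝ) (gradT T Ω u) (gradT T Ω u)).congr ?_
  filter_upwards [coeFn_gradT u] with t ht
  rw [ht, real_inner_self_eq_norm_sq]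

theorem integrable_norm_gradInv_sq (f : L2Hm1 T Ω) :
    Integrable (fun t => ‖grad Ω (invA Ω (f t))‖ ^ 2) (volume.restrict (Ioo (0 : ℝ) T)) := by
  refine (L2.integrable_inner (𝕜 := ℝ) (gradInvT T Ω f) (gradInvT T Ω f)).congr ?_
  filter_upwards [coeFn_gradInvT f] with t ht
  rw [ht, real_inner_self_eq_norm_sq]

theorem innerL2H10_eq (u v : L2H10 T Ω) :
    innerL2H10 T Ω u v = inner ℝ (gradT T Ω u) (gradT T Ω v) := by
  rw [L2.inner_def, innerL2H10]
  refine integral_congr_ae ?_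
  filter_upwards [coeFn_gradT u, coeFn_gradT v] with t h1 h2
  rw [h1, h2, innerH10]

theorem innerL2Hm1_eq (f g : L2Hm1 T Ω) :
    innerL2Hm1 T Ω f g = inner ℝ (gradInvT T Ω f) (gradInvT T Ω g) := by
  rw [L2.inner_def, innerL2Hm1]
  refine integral_congr_ae ?_
  filter_upwards [coeFn_gradInvT f, coeFn_gradInvT g] with t h1 h2
  rw [h1, h2, innerHm1, innerH10]

/-- Riesz representation through 𝒜⁻¹: the duality pairing becomes an inner product in
L²(0,T;L²(Ω;ℝᵈ)), where both norms of U₀ under the time integral also live. -/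
theorem integral_pairing_eq (hd : 0 < d) (hb : Bornology.IsBounded Ω) (f : L2Hm1 T Ω)
    (u : L2H10 T Ω) :
    Integrable (fun t => f t (u t)) (volume.restrict (Ioo (0 : ℝ) T)) ∧
    ∫ t in Ioo (0 : ℝ) T, f t (u t) = inner ℝ (gradInvT T Ω f) (gradT T Ω u) := by
  have h : (fun t => inner ℝ (gradInvT T Ω f t) (gradT T Ω u t))
      =ᵐ[volume.restrict (Ioo (0 : ℝ) T)] fun t => f t (u t) := by
    filter_upwards [coeFn_gradInvT f, coeFn_gradT u] with t h1 h2
    rw [h1, h2]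
    exact inner_grad_invA hd hb _ _
  exact ⟨(L2.integrable_inner _ _).congr h, (integral_congr_ae h).symm⟩

/-- The continuous representative is a primitive of the weak derivative. -/
theorem inner_contRep_eq (hT : 0 < T) {u : L2H10 T Ω} {g : L2Hm1 T Ω} {v : ℝ → L2 Ω}
    (hg : HasWeakTimeDeriv T Ω u g) (hv : IsContRep T Ω u v) (h0 : v 0 = 0) (p : H10 Ω) {t : ℝ}
    (ht : t ∈ Icc 0 T) : inner ℝ (v t) (emb Ω p) = ∫ s in (0 : ℝ)..t, g s p := by
  have h1 := eq_primitive_of_weakDeriv hT (z := fun t => inner ℝ (v t) (emb Ω p))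
    (g := fun t => g t p) (hv.1.inner continuousOn_const) (integrable_apply g p)
    (fun φ k1 k2 k3 => ?_) ht
  · simpa [h0] using h1
  · rw [← hasWeakTimeDeriv_iff.1 hg φ k1 k2 k3 p]
    refine integral_congr_ae ?_
    filter_upwards [hv.2] with s hs
    rw [hs]

namespace DirichletBasis

variable (b : DirichletBasis Ω)

theorem apply_w (hd : 0 < d) (hb : Bornology.IsBounded Ω) (f : Hm1 Ω) (k : b.ι) :
    f (b.w k) = b.lam k * inner ℝ (b.e k) (emb Ω (invA Ω f)) := by
  rw [← b.inner_w, real_inner_comm, inner_grad_invA hd hb]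

theorem hasSum_apply (hd : 0 < d) (hΩ : IsOpen Ω) (hb : Bornology.IsBounded Ω) (f : Hm1 Ω)
    (p : H10 Ω) : HasSum (fun k => f (b.w k) * inner ℝ (b.e k) (emb Ω p)) (f p) := by
  rw [← inner_grad_invA hd hb f p]
  refine (b.hasSum_inner_grad hd hΩ hb _ _).congr_fun fun k => ?_
  rw [b.apply_w hd hb, mul_assoc]

theorem hasSum_norm_grad_sq (hd : 0 < d) (hΩ : IsOpen Ω) (hb : Bornology.IsBounded Ω)
    (p : H10 Ω) : HasSum (fun k => b.lam k * inner ℝ (b.e k) (emb Ω p) ^ 2)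
      (‖grad Ω p‖ ^ 2) := by
  rw [← real_inner_self_eq_norm_sq]
  refine (b.hasSum_inner_grad hd hΩ hb p p).congr_fun fun k => ?_
  rw [sq]

/-- Coordinates of a dual pairing, with the bound used for dominated convergence. -/
theorem abs_apply_w_mul_le (hd : 0 < d) (hb : Bornology.IsBounded Ω) (f : Hm1 Ω) (p : H10 Ω)
    (k : b.ι) : |f (b.w k) * inner ℝ (b.e k) (emb Ω p)| ≤
      b.lam k * inner ℝ (b.e k) (emb Ω (invA Ω f)) ^ 2 +
        b.lam k * inner ℝ (b.e k) (emb Ω p) ^ 2 := by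
  rw [b.apply_w hd hb, mul_assoc, abs_mul, abs_of_pos (b.lam_pos k), ← mul_add]
  refine mul_le_mul_of_nonneg_left ?_ (b.lam_pos k).le
  set r := inner ℝ (b.e k) (emb Ω (invA Ω f))
  set q := inner ℝ (b.e k) (emb Ω p)
  rw [abs_le]
  constructor
  · nlinarith [sq_nonneg (r + q), sq_nonneg r, sq_nonneg q]
  · nlinarith [sq_nonneg (r - q), sq_nonneg r, sq_nonneg q]

/-- Parseval's identity for the pairing of `L²(0,T;H⁻¹)` and `L²(0,T;H¹₀)`. -/
theorem hasSum_pairing (hd : 0 < d) (hΩ : IsOpen Ω) (hb : Bornology.IsBounded Ω)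
    (g : L2Hm1 T Ω) (u : L2H10 T Ω) :
    (∀ k, Integrable (fun t => g t (b.w k) * inner ℝ (b.e k) (emb Ω (u t)))
      (volume.restrict (Ioo (0 : ℝ) T))) ∧
    HasSum (fun k => ∫ t in Ioo (0 : ℝ) T, g t (b.w k) * inner ℝ (b.e k) (emb Ω (u t)))
      (inner ℝ (gradInvT T Ω g) (gradT T Ω u)) := by
  have hm : ∀ k, AEStronglyMeasurable (fun t => g t (b.w k) * inner ℝ (b.e k) (emb Ω (u t)))
      (volume.restrict (Ioo (0 : ℝ) T)) := fun k =>
    (integrable_apply g _).aestronglyMeasurable.mul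
      (((innerSL ℝ (b.e k)).comp (emb Ω)).continuous.comp_aestronglyMeasurable
        (Lp.aestronglyMeasurable u))
  -- The majorant sums to ‖∇𝒜⁻¹g(t)‖² + ‖∇u(t)‖², which is integrable in time.
  have hbs : ∀ t, HasSum (fun k => b.lam k * inner ℝ (b.e k) (emb Ω (invA Ω (g t))) ^ 2 +
      b.lam k * inner ℝ (b.e k) (emb Ω (u t)) ^ 2)
      (‖grad Ω (invA Ω (g t))‖ ^ 2 + ‖grad Ω (u t)‖ ^ 2) := fun t =>
    (b.hasSum_norm_grad_sq hd hΩ hb _).add (b.hasSum_norm_grad_sq hd hΩ hb _)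
  have hi := (integrable_norm_gradInv_sq g).add (integrable_norm_grad_sq u)
  constructor
  · intro k
    refine hi.mono' (hm k) (.of_forall fun t => ?_)
    rw [Real.norm_eq_abs]
    refine (b.abs_apply_w_mul_le hd hb _ _ k).trans ?_
    refine le_hasSum (hbs t) k fun j _ => ?_
    have := b.lam_pos j
    positivity
  · rw [← (integral_pairing_eq hd hb g u).2]
    refine hasSum_integral_of_dominated_convergence _ hm
      (fun k => .of_forall fun t => b.abs_apply_w_mul_le hd hb _ _ k)
      (.of_forall fun t => (hbs t).summable) ?_
      (.of_forall fun t => b.hasSum_apply hd hΩ hb _ _)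
    simp only [fun t => (hbs t).tsum_eq]
    exact hi

end DirichletBasis

/-- The energy identity. -/
theorem inner_gradInvT_add (hd : 0 < d) (hΩ : IsOpen Ω) (hb : Bornology.IsBounded Ω) (hT : 0 < T)
    {u v : L2H10 T Ω} (hu : u ∈ U0 T Ω) (hv : v ∈ U0 T Ω) :
    inner ℝ (gradInvT T Ω (timeDeriv T Ω u)) (gradT T Ω v) +
      inner ℝ (gradInvT T Ω (timeDeriv T Ω v)) (gradT T Ω u) =
      inner ℝ (deltaT T Ω u) (deltaT T Ω v) := by
  obtain ⟨b⟩ := exists_dirichletBasis hd hΩ hb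
  obtain ⟨u', hu', hu0, huT⟩ := U0.exists_contRep hT hu
  obtain ⟨v', hv', hv0, hvT⟩ := U0.exists_contRep hT hv
  have hwu := U0.hasWeakTimeDeriv hu
  have hwv := U0.hasWeakTimeDeriv hv
  generalize timeDeriv T Ω u = g at *
  generalize timeDeriv T Ω v = h at *
  have hcu : ∀ k, ∀ t ∈ Icc 0 T, inner ℝ (b.e k) (u' t) = ∫ s in (0 : ℝ)..t, g s (b.w k) := by
    intro k t ht
    rw [← inner_contRep_eq hT hwu hu' hu0 _ ht, b.emb_w, real_inner_comm]
  have hcv : ∀ k, ∀ t ∈ Icc 0 T, inner ℝ (b.e k) (v' t) = ∫ s in (0 : ℝ)..t, h s (b.w k) := by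
    intro k t ht
    rw [← inner_contRep_eq hT hwv hv' hv0 _ ht, b.emb_w, real_inner_comm]
  obtain ⟨i1, s1⟩ := b.hasSum_pairing hd hΩ hb g v
  obtain ⟨i2, s2⟩ := b.hasSum_pairing hd hΩ hb h u
  rw [← huT, ← hvT]
  -- By Parseval the identity may be checked in each coordinate, where u and v are primitives of
  -- integrable functions with value 0 at time 0.
  refine (s1.add s2).unique ((b.hasSum_inner (u' T) (v' T)).congr_fun fun k => ?_)
  rw [← integral_add (i1 k) (i2 k), hcu k T (right_mem_Icc.2 hT.le),
    hcv k T (right_mem_Icc.2 hT.le),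
    ← integral_primitive_mul_add hT.le (integrable_apply g _) (integrable_apply h _)]
  refine integral_congr_ae ?_
  filter_upwards [hu'.2, hv'.2, ae_restrict_mem measurableSet_Ioo] with t h1 h2 h3
  rw [h1, h2, hcu k t (Ioo_subset_Icc_self h3), hcv k t (Ioo_subset_Icc_self h3)]
  ring

/-! ### The heat orbit -/

/-- The operator `𝒜`, pointwise in time. -/
def applyA (T : ℝ) (Ω : Set (EuclideanSpace ℝ (Fin d))) : L2H10 T Ω →L[ℝ] L2Hm1 T Ω :=
  applyT (V := H10 Ω) (E := Hm1 Ω) T (opA Ω)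

theorem coeFn_applyA (u : L2H10 T Ω) :
    ∀ᵐ t ∂(volume.restrict (Ioo (0 : ℝ) T)), applyA T Ω u t = opA Ω (u t) := by
  have h := coeFn_applyT (T := T) (V := H10 Ω) (E := Hm1 Ω) (opA Ω) u
  exact h

theorem gradInvT_applyA (hd : 0 < d) (hb : Bornology.IsBounded Ω) (u : L2H10 T Ω) :
    gradInvT T Ω (applyA T Ω u) = gradT T Ω u := by
  refine Lp.ext ?_
  filter_upwards [coeFn_gradInvT (applyA T Ω u), coeFn_gradT u, coeFn_applyA u] with t h1 h2 h3
  rw [h1, h2, h3, invA_opA hd hb]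

theorem coeFn_constInTime (θ : H10 Ω) :
    ∀ᵐ t ∂(volume.restrict (Ioo (0 : ℝ) T)), constInTime T Ω θ t = θ :=
  Lp.coeFn_const 2 (volume.restrict (Ioo (0 : ℝ) T)) θ

theorem memLp_two_of_continuousOn {V : Type*} [NormedAddCommGroup V] {w : ℝ → V}
    (hw : ContinuousOn w (Icc 0 T)) : MemLp w 2 (volume.restrict (Ioo (0 : ℝ) T)) := by
  obtain ⟨C, hC⟩ := isCompact_Icc.exists_bound_of_continuousOn hw
  refine MemLp.of_bound ((hw.mono Ioo_subset_Icc_self).aestronglyMeasurable measurableSet_Ioo)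
    C ?_
  filter_upwards [ae_restrict_mem measurableSet_Ioo] with t ht
  exact hC t (Ioo_subset_Icc_self ht)

/-- A continuous H¹₀-valued orbit shows that the choice is not the default, and injectivity of the
embedding identifies what was chosen. -/
theorem coeFn_heatOrbit (hΩ : IsOpen Ω) {θ : H10 Ω} {w : ℝ → H10 Ω}
    (hw : ContinuousOn w (Icc 0 T))
    (h : ∀ t, 0 ≤ t → heatSemigroup Ω t (emb Ω θ) = emb Ω (w t)) :
    ∀ᵐ t ∂(volume.restrict (Ioo (0 : ℝ) T)), heatOrbit T Ω θ t = w t := by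
  have hm := memLp_two_of_continuousOn (V := H10 Ω) hw
  have hex : ∃ w : L2H10 T Ω, ∀ᵐ t ∂(volume.restrict (Ioo (0 : ℝ) T)),
      emb Ω (w t) = heatSemigroup Ω t (emb Ω θ) := by
    refine ⟨hm.toLp w, ?_⟩
    filter_upwards [hm.coeFn_toLp, ae_restrict_mem measurableSet_Ioo] with t h1 h2
    rw [h1, h t h2.1.le]
  rw [heatOrbit, dif_pos hex]
  filter_upwards [hex.choose_spec, ae_restrict_mem measurableSet_Ioo] with t h1 h2
  exact emb_injective hΩ (h1.trans (h t h2.1.le))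

/-- `(I̲ - e^{-𝒜t})θ` is, in `L²(Ω)`, the primitive of `𝒜 e^{-𝒜t}θ`. -/
theorem exists_relax_primitive (hd : 0 < d) (hΩ : IsOpen Ω) (hb : Bornology.IsBounded Ω)
    (T : ℝ) (θ : H10 Ω) : ∃ w : ℝ → H10 Ω, ContinuousOn w (Icc 0 T) ∧ w 0 = θ ∧
      (∀ᵐ t ∂(volume.restrict (Ioo (0 : ℝ) T)), heatOrbit T Ω θ t = w t) ∧
      (∀ᵐ t ∂(volume.restrict (Ioo (0 : ℝ) T)), relax T Ω θ t = θ - w t) ∧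
      ∀ t ∈ Icc 0 T, ∀ p, inner ℝ (emb Ω (θ - w t)) (emb Ω p) =
        ∫ s in (0 : ℝ)..t, inner ℝ (grad Ω (w s)) (grad Ω p) := by
  obtain ⟨w, hw, h0, hs, hder⟩ := exists_heat_orbit hd hΩ hb θ
  have hwT : ∀ T, ContinuousOn w (Icc 0 T) := fun T => hw.mono Icc_subset_Ici_self
  have horb := coeFn_heatOrbit (T := T) hΩ (hwT T) hs
  refine ⟨w, hwT T, h0, horb, ?_, fun t ht p => ?_⟩
  · filter_upwards [horb, coeFn_constInTime (T := T) θ,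
      Lp.coeFn_sub (constInTime T Ω θ) (heatOrbit T Ω θ)] with t h1 h2 h3
    rw [relax, h3, Pi.sub_apply, h1, h2]
  · have hc : ContinuousOn (fun s => inner ℝ (grad Ω (w s)) (grad Ω p)) (Icc 0 t) :=
      ((grad Ω).continuous.comp_continuousOn (hwT t)).inner continuousOn_const
    -- The flow is known to be differentiable only for positive times; continuity at 0 suffices.
    have key := intervalIntegral.integral_eq_sub_of_hasDerivAt_of_le
      (f := fun s => -inner ℝ (emb Ω (w s)) (emb Ω p))
      (f' := fun s => inner ℝ (grad Ω (w s)) (grad Ω p)) ht.1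
      ((((emb Ω).continuous.comp_continuousOn (hwT t)).inner continuousOn_const).neg)
      (fun s hs => ?_) (hc.intervalIntegrable_of_Icc ht.1)
    · rw [key, h0, map_sub, inner_sub_left]
      ring
    · obtain ⟨v', h1, h2⟩ := hder s hs.1
      have h3 := ((h1.inner ℝ (hasDerivAt_const s (emb Ω p))).neg)
      have h4 : inner ℝ v' (emb Ω p) = -inner ℝ (grad Ω (w s)) (grad Ω p) := by
        rw [← embDual_apply, h2, ← opA_apply]
        rfl
      rw [h4, inner_zero_right, zero_add, neg_neg] at h3
      exact h3

theorem hasWeakTimeDeriv_relax (hd : 0 < d) (hΩ : IsOpen Ω) (hb : Bornology.IsBounded Ω)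
    (hT : 0 < T) (θ : H10 Ω) :
    HasWeakTimeDeriv T Ω (relax T Ω θ) (applyA T Ω (heatOrbit T Ω θ)) := by
  obtain ⟨w, hw, -, h1, h2, h3⟩ := exists_relax_primitive hd hΩ hb T θ
  rw [hasWeakTimeDeriv_iff]
  intro φ k1 k2 k3 p
  have hc : ContinuousOn (fun s => inner ℝ (grad Ω (w s)) (grad Ω p)) (Icc 0 T) :=
    ((grad Ω).continuous.comp_continuousOn hw).inner continuousOn_const
  have key := integral_deriv_mul_primitive hT.le
    ((hc.integrableOn_Icc (μ := volume)).mono_set Ioo_subset_Icc_self) k1 k3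
  have e1 : ∫ t in Ioo (0 : ℝ) T, deriv φ t * inner ℝ (emb Ω (relax T Ω θ t)) (emb Ω p) =
      ∫ t in Ioo 0 T, deriv φ t * ∫ s in (0 : ℝ)..t, inner ℝ (grad Ω (w s)) (grad Ω p) := by
    refine integral_congr_ae ?_
    filter_upwards [h2, ae_restrict_mem measurableSet_Ioo] with t ht hm
    rw [ht, h3 t (Ioo_subset_Icc_self hm)]
  have e2 : ∫ t in Ioo (0 : ℝ) T, φ t * applyA T Ω (heatOrbit T Ω θ) t p =
      ∫ t in Ioo 0 T, φ t * inner ℝ (grad Ω (w t)) (grad Ω p) := by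
    refine integral_congr_ae ?_
    filter_upwards [h1, coeFn_applyA (heatOrbit T Ω θ)] with t h1 h2
    rw [h2, h1, opA_apply]
  rw [e1, e2, key]

theorem relax_mem_U0 (hd : 0 < d) (hΩ : IsOpen Ω) (hb : Bornology.IsBounded Ω)
    (hT : 0 < T) (θ : H10 Ω) : relax T Ω θ ∈ U0 T Ω := by
  obtain ⟨w, hw, h0, -, h2, -⟩ := exists_relax_primitive hd hΩ hb T θ
  refine ⟨⟨_, hasWeakTimeDeriv_relax hd hΩ hb hT θ⟩, fun t => emb Ω (θ - w t),
    ⟨(emb Ω).continuous.comp_continuousOn (continuousOn_const.sub hw), ?_⟩, ?_⟩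
  · filter_upwards [h2] with t ht
    rw [ht]
  · simp only [h0, sub_self, map_zero]

theorem timeDeriv_relax (hd : 0 < d) (hΩ : IsOpen Ω) (hb : Bornology.IsBounded Ω)
    (hT : 0 < T) (θ : H10 Ω) :
    timeDeriv T Ω (relax T Ω θ) = applyA T Ω (heatOrbit T Ω θ) :=
  timeDeriv_eq (hasWeakTimeDeriv_relax hd hΩ hb hT θ)

/-! ### The scalar product of `U₀` -/

theorem innerU0_eq (u v : L2H10 T Ω) : innerU0 T Ω u v = inner ℝ (gradT T Ω u) (gradT T Ω v) +
    inner ℝ (gradInvT T Ω (timeDeriv T Ω u)) (gradInvT T Ω (timeDeriv T Ω v)) +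
    inner ℝ (deltaT T Ω u) (deltaT T Ω v) := by
  rw [innerU0, innerL2H10_eq, innerL2Hm1_eq]

theorem innerU0_comm (u v : L2H10 T Ω) : innerU0 T Ω u v = innerU0 T Ω v u := by
  rw [innerU0_eq, innerU0_eq, real_inner_comm (gradT T Ω u),
    real_inner_comm (gradInvT T Ω (timeDeriv T Ω u)), real_inner_comm (deltaT T Ω u)]

theorem innerH10_comm (u v : H10 Ω) : innerH10 Ω u v = innerH10 Ω v u := real_inner_comm _ _

theorem innerU0_add_left (hT : 0 < T) {u u' : L2H10 T Ω} (hu : u ∈ U0 T Ω) (hu' : u' ∈ U0 T Ω)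
    (v : L2H10 T Ω) : innerU0 T Ω (u + u') v = innerU0 T Ω u v + innerU0 T Ω u' v := by
  rw [innerU0_eq, innerU0_eq, innerU0_eq, timeDeriv_add hu hu', deltaT_add hT hu hu',
    (gradT T Ω).map_add, (gradInvT T Ω).map_add, inner_add_left, inner_add_left, inner_add_left]
  ring

theorem innerH10_add_left (u u' v : H10 Ω) :
    innerH10 Ω (u + u') v = innerH10 Ω u v + innerH10 Ω u' v := by
  rw [innerH10, map_add, inner_add_left, innerH10, innerH10]

theorem inner_gradT_constInTime (θ : H10 Ω) (v : L2H10 T Ω) :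
    inner ℝ (gradT T Ω (constInTime T Ω θ)) (gradT T Ω v) = innerH10 Ω θ (opB T Ω v) := by
  have h := ((innerSL ℝ (grad Ω θ)).comp (grad Ω)).integral_comp_comm (integrable_Lp v)
  rw [innerH10, opB]
  refine Eq.trans ?_ h
  rw [L2.inner_def]
  refine integral_congr_ae ?_
  filter_upwards [coeFn_gradT (constInTime T Ω θ), coeFn_gradT v, coeFn_constInTime (T := T) θ]
    with t h1 h2 h3
  rw [h1, h2, h3]
  rfl

/-- Since v is a primitive of v_t with v(0) = 0, pairing with a constant in time leaves only the end
value. -/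
theorem inner_gradInvT_constInTime (hd : 0 < d) (hb : Bornology.IsBounded Ω) (hT : 0 < T)
    (θ : H10 Ω) {v : L2H10 T Ω} (hv : v ∈ U0 T Ω) :
    inner ℝ (gradInvT T Ω (timeDeriv T Ω v)) (gradT T Ω (constInTime T Ω θ)) =
      inner ℝ (deltaT T Ω v) (emb Ω θ) := by
  obtain ⟨v', hv', h0, h1⟩ := U0.exists_contRep hT hv
  rw [← h1, inner_contRep_eq hT (U0.hasWeakTimeDeriv hv) hv' h0 θ (right_mem_Icc.2 hT.le),
    ← (integral_pairing_eq hd hb _ _).2, intervalIntegral.integral_of_le hT.le,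
    integral_Ioc_eq_integral_Ioo]
  refine integral_congr_ae ?_
  filter_upwards [coeFn_constInTime (T := T) θ] with t h3
  rw [h3]

/-- The adjoint of `I̲ - e^{-𝒜t}` is `𝒜⁻¹δ_T + B`. -/
theorem innerU0_relax (hd : 0 < d) (hΩ : IsOpen Ω) (hb : Bornology.IsBounded Ω) (hT : 0 < T)
    (θ : H10 Ω) {v : L2H10 T Ω} (hv : v ∈ U0 T Ω) :
    innerU0 T Ω (relax T Ω θ) v = innerH10 Ω (invAL2 Ω (deltaT T Ω v) + opB T Ω v) θ := by
  have h1 := inner_gradInvT_add hd hΩ hb hT (relax_mem_U0 hd hΩ hb hT θ) hv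
  have h2 : gradT T Ω (relax T Ω θ) =
      gradT T Ω (constInTime T Ω θ) - gradT T Ω (heatOrbit T Ω θ) := (gradT T Ω).map_sub _ _
  have h3 : innerH10 Ω (invAL2 Ω (deltaT T Ω v)) θ = inner ℝ (deltaT T Ω v) (emb Ω θ) :=
    inner_grad_invAL2 hd hb _ _
  -- With h = e^{-𝒜t}θ, the energy identity writes the end-time product as ∫∇h·∇v + ⟨v_t, θ - h⟩. In
  -- the U₀ product all terms with h then cancel, leaving ⟨θ, Bv⟩ + (v(T), θ).
  rw [timeDeriv_relax hd hΩ hb hT, gradInvT_applyA hd hb, h2, inner_sub_right,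
    inner_gradInvT_constInTime hd hb hT θ hv] at h1
  rw [innerU0_eq, ← h1, timeDeriv_relax hd hΩ hb hT, gradInvT_applyA hd hb, h2, inner_sub_left,
    inner_gradT_constInTime, innerH10_add_left, h3, innerH10_comm (opB T Ω v),
    real_inner_comm (gradT T Ω (heatOrbit T Ω θ))
      (gradInvT T Ω (timeDeriv T Ω v))]
  ring

/-! ### The block operators -/

theorem invSqrtA_emb_invSqrtA (hd : 0 < d) (hΩ : IsOpen Ω) (hb : Bornology.IsBounded Ω)
    (g : L2 Ω) : invSqrtA Ω (emb Ω (invSqrtA Ω g)) = invAL2 Ω g := by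
  obtain ⟨b⟩ := exists_dirichletBasis hd hΩ hb
  rw [b.invSqrtA_eq hd hΩ hb]
  exact emb_injective hΩ (congrArg (fun f => f g) (b.isInvSqrt_invSqrt hd hb).2)

theorem innerH10_invSqrtA (hd : 0 < d) (hΩ : IsOpen Ω) (hb : Bornology.IsBounded Ω)
    (g h : L2 Ω) : innerH10 Ω (invSqrtA Ω g) (invSqrtA Ω h) = inner ℝ g h := by
  obtain ⟨b⟩ := exists_dirichletBasis hd hΩ hb
  rw [b.invSqrtA_eq hd hΩ hb]
  exact b.inner_grad_invSqrt hd hb g h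

theorem innerH10_invSqrtA_emb_comm (hd : 0 < d) (hΩ : IsOpen Ω) (hb : Bornology.IsBounded Ω)
    (u v : H10 Ω) :
    innerH10 Ω (invSqrtA Ω (emb Ω u)) v = innerH10 Ω u (invSqrtA Ω (emb Ω v)) := by
  obtain ⟨b⟩ := exists_dirichletBasis hd hΩ hb
  rw [b.invSqrtA_eq hd hΩ hb]
  exact b.inner_grad_invSqrt_comm hd hb u v

theorem psiC0_symm (hd : 0 < d) (hΩ : IsOpen Ω) (hb : Bornology.IsBounded Ω) (hT : 0 < T)
    {x y : State T Ω} (hx : x.1 ∈ U0 T Ω) (hy : y.1 ∈ U0 T Ω) :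
    innerState T Ω (psiC0 T Ω x) y = innerState T Ω x (psiC0 T Ω y) := by
  have hr := relax_mem_U0 hd hΩ hb hT
  simp only [innerState, psiC0, block, id]
  rw [innerU0_add_left hT hx (hr _), innerU0_comm x.1 (y.1 + _), innerU0_add_left hT hy (hr _),
    innerU0_comm y.1, innerU0_relax hd hΩ hb hT _ hx, innerU0_relax hd hΩ hb hT _ hy,
    innerH10_comm x.2, innerH10_add_left (_ + _) (invSqrtA Ω _),
    innerH10_add_left (_ + _) (invSqrtA Ω _), innerH10_invSqrtA_emb_comm hd hΩ hb,
    innerH10_comm x.2]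
  ring

/-- The second row of 𝒜̃𝒞̃ is 𝒜⁻¹δ_T u + 𝒜⁻¹θ; the term -𝒜⁻¹ in ℛ removes the surplus 𝒜⁻¹θ. -/
theorem psiC0_eq (hd : 0 < d) (hΩ : IsOpen Ω) (hb : Bornology.IsBounded Ω) (x : State T Ω) :
    psiC0 T Ω x = opAtilde T Ω (opCtilde T Ω x) + opR T Ω x := by
  refine Prod.ext ?_ ?_
  · simp [psiC0, opAtilde, opCtilde, opR, block]
  · simp only [psiC0, opAtilde, opCtilde, opR, block, Prod.snd_add, Pi.zero_apply, zero_add]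
    rw [map_add, map_add, invSqrtA_emb_invSqrtA hd hΩ hb, invSqrtA_emb_invSqrtA hd hΩ hb]
    abel

theorem add_add_eq_add_add_sub {G : Type*} [AddCommGroup G] (a b c e : G) :
    a + b + c = a + e + (b + (c - e)) := by abel

theorem applyA_constInTime (θ : H10 Ω) : applyA T Ω (constInTime T Ω θ) =
    Lp.const 2 (volume.restrict (Ioo (0 : ℝ) T)) (opA Ω θ) := by
  refine Lp.ext ?_
  filter_upwards [coeFn_applyA (constInTime T Ω θ), coeFn_constInTime (T := T) θ,
    Lp.coeFn_const 2 (volume.restrict (Ioo (0 : ℝ) T)) (opA Ω θ)] with t h1 h2 h3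
  rw [h1, h2, h3]
  rfl

theorem applyA_relax (θ : H10 Ω) : applyA T Ω (relax T Ω θ) =
    Lp.const 2 (volume.restrict (Ioo (0 : ℝ) T)) (opA Ω θ) - applyA T Ω (heatOrbit T Ω θ) := by
  have h := (applyA T Ω).map_sub (constInTime T Ω θ) (heatOrbit T Ω θ)
  exact h.trans (congrArg (fun f => f - _) (applyA_constInTime θ))

/-- For z = θ - h with h = e^{-𝒜t}θ one has z_t + 𝒜z = 𝒜h + 𝒜(θ - h) = 𝒜θ. -/
theorem opG_fst_eq (hd : 0 < d) (hΩ : IsOpen Ω) (hb : Bornology.IsBounded Ω) (hT : 0 < T)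
    {u : L2H10 T Ω} (hu : u ∈ U0 T Ω) (θ : H10 Ω) : (opG T Ω (u, θ)).1 =
      timeDeriv T Ω (u + relax T Ω θ) + applyA T Ω (u + relax T Ω θ) := by
  have h3 : timeDeriv T Ω (u + relax T Ω θ) = timeDeriv T Ω u + applyA T Ω (heatOrbit T Ω θ) :=
    (timeDeriv_add hu (relax_mem_U0 hd hΩ hb hT θ)).trans
      (congrArg _ (timeDeriv_relax hd hΩ hb hT θ))
  have h4 := ((applyA T Ω).map_add u (relax T Ω θ)).trans
    (congrArg (fun f => _ + f) (applyA_relax θ))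
  refine Eq.trans ?_ (congrArg₂ (fun f g => f + g) h3.symm h4.symm)
  exact add_add_eq_add_add_sub (G := L2Hm1 T Ω) (timeDeriv T Ω u) (applyA T Ω u)
    (Lp.const 2 (volume.restrict (Ioo (0 : ℝ) T)) (opA Ω θ)) (applyA T Ω (heatOrbit T Ω θ))

/-- In the expanded square the cross term 2⟨z_t, z⟩ equals ‖z(T)‖²; this is why the end value
appears in the scalar product of U₀. -/
theorem innerL2Hm1_timeDeriv_add_applyA (hd : 0 < d) (hΩ : IsOpen Ω) (hb : Bornology.IsBounded Ω)
    (hT : 0 < T) {z : L2H10 T Ω} (hz : z ∈ U0 T Ω) :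
    innerL2Hm1 T Ω (timeDeriv T Ω z + applyA T Ω z) (timeDeriv T Ω z + applyA T Ω z) =
      innerU0 T Ω z z := by
  have he := inner_gradInvT_add hd hΩ hb hT hz hz
  have h : gradInvT T Ω (timeDeriv T Ω z + applyA T Ω z) =
      gradInvT T Ω (timeDeriv T Ω z) + gradT T Ω z :=
    ((gradInvT T Ω).map_add _ _).trans (congrArg (fun f => _ + f) (gradInvT_applyA hd hb z))
  rw [innerL2Hm1_eq, h, innerU0_eq, ← he, inner_add_left, inner_add_right, inner_add_right,
    real_inner_comm (gradT T Ω z) (gradInvT T Ω (timeDeriv T Ω z))]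
  ring

theorem normState_opCtilde_eq (hd : 0 < d) (hΩ : IsOpen Ω) (hb : Bornology.IsBounded Ω)
    (hT : 0 < T) {x : State T Ω} (hx : x.1 ∈ U0 T Ω) :
    normState T Ω (opCtilde T Ω x) = normData T Ω (opG T Ω x) := by
  obtain ⟨u, θ⟩ := x
  have h1 : (opCtilde T Ω (u, θ)).2 = invSqrtA Ω (deltaT T Ω u + emb Ω θ) :=
    (map_add (invSqrtA Ω) _ _).symm
  have h2 : (opCtilde T Ω (u, θ)).1 = u + relax T Ω θ := rfl
  have h3 : (opG T Ω (u, θ)).2 = deltaT T Ω u + emb Ω θ := rfl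
  rw [normState, normData, innerState, opG_fst_eq hd hΩ hb hT hx, h1, h2, h3,
    innerH10_invSqrtA hd hΩ hb, real_inner_self_eq_norm_sq,
    innerL2Hm1_timeDeriv_add_applyA hd hΩ hb hT (U0.add hx (relax_mem_U0 hd hΩ hb hT θ))]

/-! ### Orders of the operators -/

theorem norm_deltaT_le_normState_opCtilde (hd : 0 < d) (hΩ : IsOpen Ω) (hb : Bornology.IsBounded Ω)
    (u : L2H10 T Ω) : ‖deltaT T Ω u‖ ≤ normState T Ω (opCtilde T Ω (u, 0)) := by
  refine Real.le_sqrt_of_sq_le ?_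
  have h1 : (opCtilde T Ω (u, 0)).2 = invSqrtA Ω (deltaT T Ω u) := by
    simp [opCtilde, block]
  rw [innerState, h1, innerH10_invSqrtA hd hΩ hb, real_inner_self_eq_norm_sq, innerU0_eq,
    real_inner_self_eq_norm_sq, real_inner_self_eq_norm_sq, real_inner_self_eq_norm_sq]
  linarith [sq_nonneg ‖gradT T Ω (opCtilde T Ω (u, 0)).1‖,
    sq_nonneg ‖gradInvT T Ω (timeDeriv T Ω (opCtilde T Ω (u, 0)).1)‖,
    sq_nonneg ‖deltaT T Ω (opCtilde T Ω (u, 0)).1‖]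

theorem coeFn_toLp_of_continuousOn {V : Type*} [NormedAddCommGroup V] {w : ℝ → V}
    (hw : ContinuousOn w (Icc 0 T)) : ∃ u : Lp V 2 (volume.restrict (Ioo (0 : ℝ) T)),
    ∀ᵐ t ∂(volume.restrict (Ioo (0 : ℝ) T)), u t = w t :=
  ⟨(memLp_two_of_continuousOn hw).toLp w, (memLp_two_of_continuousOn hw).coeFn_toLp⟩

/-- The functions `t ↦ t^(n+1) p`. -/
theorem exists_pow_smul_mem_U0 (hT : 0 < T) (p : H10 Ω) (n : ℕ) : ∃ u ∈ U0 T Ω,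
    deltaT T Ω u = T ^ (n + 1) • emb Ω p ∧
    innerL2H10 T Ω u u = T ^ (2 * n + 3) / (2 * n + 3) * ‖grad Ω p‖ ^ 2 := by
  -- The exponent n + 1 makes the value at time 0 vanish also for n = 0.
  obtain ⟨u, hu⟩ := coeFn_toLp_of_continuousOn (V := H10 Ω) (T := T)
    (w := fun t => t ^ (n + 1) • p) (by fun_prop)
  obtain ⟨g, hg⟩ := coeFn_toLp_of_continuousOn (V := Hm1 Ω) (T := T)
    (w := fun t => ((n + 1) * t ^ n) • embDual Ω (emb Ω p))
    (((continuous_const.mul (continuous_pow n)).smul continuous_const).continuousOn)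
  have hprim : ∀ t : ℝ, ∫ s in (0 : ℝ)..t, ((n + 1 : ℝ) * s ^ n) = t ^ (n + 1) := by
    intro t
    rw [intervalIntegral.integral_const_mul, integral_pow]
    have : (n : ℝ) + 1 ≠ 0 := by positivity
    field_simp
    simp
  have hrep : IsContRep T Ω u fun t => t ^ (n + 1) • emb Ω p := by
    refine ⟨by fun_prop, ?_⟩
    filter_upwards [hu] with t ht
    rw [ht, map_smul]
  have hder : HasWeakTimeDeriv T Ω u g := by
    rw [hasWeakTimeDeriv_iff]
    intro φ h1 h2 h3 q
    have key := integral_deriv_mul_primitive (T := T) (g := fun s : ℝ => (n + 1 : ℝ) * s ^ n)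
      hT.le (Continuous.integrableOn_Icc (by fun_prop) |>.mono_set Ioo_subset_Icc_self) h1 h3
    simp only [hprim] at key
    have e1 : ∫ t in Ioo (0 : ℝ) T, deriv φ t * inner ℝ (emb Ω (u t)) (emb Ω q) =
        (∫ t in Ioo (0 : ℝ) T, deriv φ t * t ^ (n + 1)) * inner ℝ (emb Ω p) (emb Ω q) := by
      rw [← integral_mul_const]
      refine integral_congr_ae ?_
      filter_upwards [hu] with t ht
      rw [ht, map_smul, real_inner_smul_left, mul_assoc]
    have e2 : ∫ t in Ioo (0 : ℝ) T, φ t * g t q =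
        (∫ t in Ioo (0 : ℝ) T, φ t * ((n + 1) * t ^ n)) * inner ℝ (emb Ω p) (emb Ω q) := by
      rw [← integral_mul_const]
      refine integral_congr_ae ?_
      filter_upwards [hg] with t ht
      rw [ht, mul_assoc]
      rfl
    rw [e1, e2, key, neg_mul]
  refine ⟨u, ⟨⟨g, hder⟩, _, hrep, by simp⟩, deltaT_eq hT hrep, ?_⟩
  have e : innerL2H10 T Ω u u = ∫ t in Ioo (0 : ℝ) T, t ^ (2 * n + 2) * ‖grad Ω p‖ ^ 2 := by
    refine integral_congr_ae ?_
    filter_upwards [hu] with t ht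
    rw [ht, innerH10, map_smul, real_inner_smul_left, real_inner_smul_right,
      real_inner_self_eq_norm_sq]
    ring
  rw [e, integral_mul_const, ← integral_Ioc_eq_integral_Ioo,
    ← intervalIntegral.integral_of_le hT.le, integral_pow]
  congr 1
  push_cast
  rw [zero_pow (by omega), sub_zero]
  congr 1
  ring

theorem not_exists_opCtilde_le (hd : 0 < d) (hΩ : IsOpen Ω) (hb : Bornology.IsBounded Ω)
    (hne : Ω.Nonempty) (hT : 0 < T) :
    ¬ ∃ C : ℝ, ∀ x ∈ stateSpace T Ω, normState T Ω (opCtilde T Ω x) ≤ C * weakNorm T Ω x := by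
  rintro ⟨C, hC⟩
  obtain ⟨p, hp⟩ := exists_H10_ne_zero hΩ hne
  have hp' : 0 < ‖emb Ω p‖ ^ 2 := by positivity
  -- For u = t^{n+1}p the estimate reduces to (2n + 3)‖p‖² ≤ C²T‖∇p‖², which this n violates.
  obtain ⟨n, hn⟩ := exists_nat_gt (C ^ 2 * (T * ‖grad Ω p‖ ^ 2) / ‖emb Ω p‖ ^ 2)
  rw [div_lt_iff₀ hp'] at hn
  obtain ⟨u, hu, h1, h2⟩ := exists_pow_smul_mem_U0 hT p n
  have h3 := (norm_deltaT_le_normState_opCtilde hd hΩ hb u).trans (hC (u, 0) ⟨hu, mem_univ _⟩)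
  have h4 : weakNorm T Ω (u, 0) ^ 2 = T ^ (2 * n + 3) / (2 * n + 3) * ‖grad Ω p‖ ^ 2 := by
    rw [weakNorm, Real.sq_sqrt]
    · simp [h2]
    · simp only [h2]
      positivity
  have h5 := pow_le_pow_left₀ (norm_nonneg _) h3 2
  rw [mul_pow, h4, h1, norm_smul, mul_pow, norm_pow, Real.norm_of_nonneg hT.le] at h5
  have h6 : T ^ (2 * n + 2) * ((2 * n + 3) * ‖emb Ω p‖ ^ 2) ≤
      T ^ (2 * n + 2) * (C ^ 2 * (T * ‖grad Ω p‖ ^ 2)) := by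
    have h7 := mul_le_mul_of_nonneg_left h5 (by positivity : (0 : ℝ) ≤ 2 * n + 3)
    calc _ = (2 * n + 3) * ((T ^ (n + 1)) ^ 2 * ‖emb Ω p‖ ^ 2) := by ring
      _ ≤ _ := h7
      _ = _ := by
        field_simp
        ring
  have h8 := le_of_mul_le_mul_left h6 (by positivity)
  have : 0 ≤ (n : ℝ) * ‖emb Ω p‖ ^ 2 := by positivity
  linarith

theorem norm_integral_sq_le {E : Type*} [NormedAddCommGroup E] [InnerProductSpace ℝ E]
    (hT : 0 ≤ T) (f : Lp E 2 (volume.restrict (Ioo (0 : ℝ) T))) :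
    ‖∫ t in Ioo (0 : ℝ) T, f t‖ ^ 2 ≤ T * ‖f‖ ^ 2 := by
  have h1 : Integrable (fun t => ‖f t‖ ^ 2) (volume.restrict (Ioo (0 : ℝ) T)) := by
    simpa only [real_inner_self_eq_norm_sq] using L2.integrable_inner (𝕜 := ℝ) f f
  have h2 := sq_integral_le_measureReal_mul (integrable_Lp f).norm h1
  rw [← real_inner_self_eq_norm_sq f, L2.inner_def]
  simp only [real_inner_self_eq_norm_sq]
  have h3 : (volume.restrict (Ioo (0 : ℝ) T)).real univ = T := by
    simp [measureReal_def, hT]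
  rw [h3] at h2
  exact (pow_le_pow_left₀ (norm_nonneg _) (norm_integral_le_integral_norm _) 2).trans h2

theorem norm_grad_opB_le (hT : 0 ≤ T) (u : L2H10 T Ω) :
    ‖grad Ω (opB T Ω u)‖ ≤ √T * ‖gradT T Ω u‖ := by
  have h : grad Ω (opB T Ω u) = ∫ t in Ioo (0 : ℝ) T, gradT T Ω u t := by
    have h := (grad Ω).integral_comp_comm (integrable_Lp u)
    rw [opB, ← h]
    refine integral_congr_ae ?_
    filter_upwards [coeFn_gradT u] with t ht
    rw [ht]
  rw [h]
  refine (sq_le_sq₀ (norm_nonneg _) (by positivity)).1 ?_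
  rw [mul_pow, Real.sq_sqrt hT]
  exact norm_integral_sq_le hT _

/-- The three terms of the constant: Cauchy-Schwarz in time bounds B by √T, the isometry 𝒜^{-1/2}
contributes 1, and 𝒜⁻¹ its norm from L² to H¹₀. -/
theorem exists_opR_le (hd : 0 < d) (hΩ : IsOpen Ω) (hb : Bornology.IsBounded Ω) (hT : 0 < T) :
    ∃ C : ℝ, ∀ x ∈ stateSpace T Ω, normState T Ω (opR T Ω x) ≤ C * weakNorm T Ω x := by
  refine ⟨√T + 1 + ‖(grad Ω).comp (invAL2 Ω)‖, fun x _ => ?_⟩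
  obtain ⟨u, θ⟩ := x
  have h1 : (opR T Ω (u, θ)).1 = 0 := by simp [opR, block]
  have h2 : normState T Ω (opR T Ω (u, θ)) =
      ‖grad Ω (opB T Ω u + (invSqrtA Ω (emb Ω θ) - invAL2 Ω (emb Ω θ)))‖ := by
    rw [normState, innerState, h1, innerU0_eq, timeDeriv_eq hasWeakTimeDeriv_zero,
      deltaT_eq hT isContRep_zero, (gradT T Ω).map_zero, (gradInvT T Ω).map_zero, Pi.zero_apply,
      inner_zero_left, inner_zero_left, add_zero, add_zero, zero_add, innerH10,
      real_inner_self_eq_norm_sq, Real.sqrt_sq (norm_nonneg _)]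
    rfl
  have h3 : ‖grad Ω (invSqrtA Ω (emb Ω θ))‖ = ‖emb Ω θ‖ := by
    have := innerH10_invSqrtA hd hΩ hb (emb Ω θ) (emb Ω θ)
    rw [innerH10, real_inner_self_eq_norm_sq, real_inner_self_eq_norm_sq] at this
    exact (sq_eq_sq₀ (norm_nonneg _) (norm_nonneg _)).1 this
  have h4 : ‖grad Ω (invAL2 Ω (emb Ω θ))‖ ≤ ‖(grad Ω).comp (invAL2 Ω)‖ * ‖emb Ω θ‖ :=
    ((grad Ω).comp (invAL2 Ω)).le_opNorm _
  have h5 : ‖gradT T Ω u‖ ≤ weakNorm T Ω (u, θ) := by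
    refine Real.le_sqrt_of_sq_le ?_
    rw [innerL2H10_eq, real_inner_self_eq_norm_sq]
    exact le_add_of_nonneg_right (by positivity)
  have h6 : ‖emb Ω θ‖ ≤ weakNorm T Ω (u, θ) := by
    refine Real.le_sqrt_of_sq_le ?_
    rw [innerL2H10_eq, real_inner_self_eq_norm_sq]
    exact le_add_of_nonneg_left (by positivity)
  rw [h2, map_add, map_sub]
  calc _ ≤ ‖grad Ω (opB T Ω u)‖ + (‖grad Ω (invSqrtA Ω (emb Ω θ))‖ +
        ‖grad Ω (invAL2 Ω (emb Ω θ))‖) :=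
        (norm_add_le _ _).trans (add_le_add le_rfl (norm_sub_le _ _))
    _ ≤ √T * weakNorm T Ω (u, θ) + (weakNorm T Ω (u, θ) +
        ‖(grad Ω).comp (invAL2 Ω)‖ * weakNorm T Ω (u, θ)) := by
        refine add_le_add ((norm_grad_opB_le hT.le u).trans ?_) (add_le_add (h3.trans_le h6)
          (h4.trans ?_))
        · gcongr
        · gcongr
    _ = _ := by ring

end BackwardHeat

end

open BackwardHeat

/-! ### The theorem. -/

theorem mainTheorem8 (d : ℕ) (hd : 0 < d) (Ω : Set (EuclideanSpace ℝ (Fin d)))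
    (hΩ_open : IsOpen Ω) (hΩ_bdd : Bornology.IsBounded Ω) (hΩ_ne : Ω.Nonempty)
    (T : ℝ) (hT : 0 < T) :
    -- the operators map `U₀ × H¹₀` into itself
    (MapsTo (psiC0 T Ω) (stateSpace T Ω) (stateSpace T Ω) ∧
      MapsTo (opAtilde T Ω) (stateSpace T Ω) (stateSpace T Ω) ∧
      MapsTo (opCtilde T Ω) (stateSpace T Ω) (stateSpace T Ω) ∧
      MapsTo (opR T Ω) (stateSpace T Ω) (stateSpace T Ω)) ∧
    -- symmetry
    (∀ x ∈ stateSpace T Ω, ∀ y ∈ stateSpace T Ω,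
      innerState T Ω (psiC0 T Ω x) y = innerState T Ω x (psiC0 T Ω y)) ∧
    -- splitting
    (∀ x ∈ stateSpace T Ω, psiC0 T Ω x = opAtilde T Ω (opCtilde T Ω x) + opR T Ω x) ∧
    -- the remainder is of lower order, the operator `𝒞̃` is not
    ((∃ C : ℝ, ∀ x ∈ stateSpace T Ω, normState T Ω (opR T Ω x) ≤ C * weakNorm T Ω x) ∧
      ¬ ∃ C : ℝ, ∀ x ∈ stateSpace T Ω,
        normState T Ω (opCtilde T Ω x) ≤ C * weakNorm T Ω x) ∧
    -- equality of norms
    (∀ x ∈ stateSpace T Ω, normState T Ω (opCtilde T Ω x) = normData T Ω (opG T Ω x)) := by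
  have hr := relax_mem_U0 hd hΩ_open hΩ_bdd hT
  refine ⟨⟨fun x hx => ⟨U0.add hx.1 (hr _), mem_univ _⟩, fun x hx => ⟨?_, mem_univ _⟩,
    fun x hx => ⟨U0.add hx.1 (hr _), mem_univ _⟩,
    fun x _ => ⟨U0.add zero_mem_U0 zero_mem_U0, mem_univ _⟩⟩,
    fun x hx y hy => psiC0_symm hd hΩ_open hΩ_bdd hT hx.1 hy.1,
    fun x _ => psiC0_eq hd hΩ_open hΩ_bdd x,
    ⟨exists_opR_le hd hΩ_open hΩ_bdd hT,
      not_exists_opCtilde_le hd hΩ_open hΩ_bdd hΩ_ne hT⟩,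
    fun x hx => normState_opCtilde_eq hd hΩ_open hΩ_bdd hT hx.1⟩
  exact U0.add hx.1 zero_mem_U0
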